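/- For a positive integer $n$ let $\Omega(n)$ denote the number of prime factors of $n$ counted with multiplicity (so $\Omega(1)=0$), and let $\lambda(n)=(-1)^{\Omega(n)}$ be the Liouville function. Then for every bounded function $f\colon\{0,1,2,\dots\}\to\mathbb{C}$, $$\lim_{N\to\infty}\left(\frac1N\sum_{n=1}^N f(\Omega(n)+1)-\frac1N\sum_{n=1}^N f(\Omega(n))\right)=0.$$ Moreover, the following special cases and consequences hold. (1) $\displaystyle\lim_{N\to\infty}\frac1N\sum_{n=1}^N\lambda(n)=0$. (2) For every integer $m\ge 1$ and every $\zeta\in\mathbb{C}$ with $\zeta^m=1$ and $\zeta\ne1$, $\displaystyle\lim_{N\to\infty}\frac1N\sum_{n=1}^N\zeta^{\Omega(n)}=0$. (3) (Pillai, Selberg) For every integer $m\ge1$ and every $r\in\{0,1,\dots,m-1\}$, the set $\{n\ge 1:\Omega(n)\equiv r \bmod m\}$ has asymptotic density $1/m$, that is, $\displaystyle\lim_{N\to\infty}\frac1N\,|\{1\le n\le N:\Omega(n)\equiv r \bmod m\}|=\frac1m$. (4) (Erdős, Delange) For every irrational real number $\alpha$, the sequence $(\Omega(n)\alpha)_{n\ge1}$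 is uniformly distributed mod $1$, that is, for all $0\le a<b\le1$, $\displaystyle\lim_{N\to\infty}\frac1N\,|\{1\le n\le N:\{\Omega(n)\alpha\}\in[a,b)\}|=b-a$, where $\{x\}$ denotes the fractional part of $x$. -/

import Mathlib

open scoped Classical in
/-- The set `A` of natural numbers has natural (asymptotic) density `d`:
`#{1 ≤ n ≤ N : n ∈ A} / N → d` as `N → ∞`. -/
def HasNaturalDensity (A : Set ℕ) (d : ℝ) : Prop :=
  Filter.Tendsto
    (fun N : ℕ => (((Finset.Icc 1 N).filter (fun n => n ∈ A)).card : ℝ) / (N : ℝ))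
    Filter.atTop (nhds d)

/-- The sequence `x 1, x 2, x 3, …` of real numbers is uniformly distributed mod 1: for every
interval `[a, b) ⊆ [0, 1)`, the indices `n` for which the fractional part of `x n` lies in
`[a, b)` have density `b - a`. -/
def UniformlyDistributedModOne (x : ℕ → ℝ) : Prop :=
  ∀ a b : ℝ, 0 ≤ a → a < b → b ≤ 1 →
    HasNaturalDensity {n : ℕ | Int.fract (x n) ∈ Set.Ico a b} (b - a)

/-! ### Interpolated mean values and the Turán–Kubilius inequality -/

section

open Finset Filter Topology MeasureTheory

/-! Put `a n = f (Ω n)` and `b n = f (Ω n + 1)`, so that `a (p m) = b m` for every prime `p`. For a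
finite set of primes with weights `c p` in [0, 1], the weighted number of primes dividing `n` is
close to `S = ∑ c p / p` for most `n` (Turán–Kubilius). Hence S times the mean of `a` up to `y`
equals `∑ (c p / p)` times the mean of `b` up to `y / p`, with error `√S + 1` for large `y`
(`eventually_norm_contMean_sub_prime_average_le`).

If the means of `b` up to `y / p` and up to `y` agree asymptotically, dividing by a large S finishes
the proof. This slow variation is itself derived from Turán–Kubilius: comparing `y` with `y / q`, it
suffices that averages over primes of `g (log p)` and `g (log p + log q)` agree, where `g u` is the
mean of `b` up to `y * exp (-u)`, a bounded Lipschitz function.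

That shift invariance is the prime-number input. The exponential sums `∑ Λ(n) n ^ (-1 - σ + i t) (1
- q ^ (i t))` are bounded uniformly in `σ` for bounded `t`, because ζ has no zeros on the line Re s
= 1 and the second factor cancels the pole. A Fourier duality bound
(`exists_norm_sum_le_of_exponential_sum_bounded`) turns this into invariance for all admissible `g`
at once.

The consequences apply the result to `z ^ k` and to indicators of residue classes, with Weyl's
criterion for irrational rotations. -/

/-- The mean value `y⁻¹ ∑_{n ≤ y} a n`, interpolated linearly between consecutive integers in the
numerator. -/
noncomputable def contMean (a : ℕ → ℂ) (y : ℝ) : ℂ :=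
  (y : ℂ)⁻¹ * ∫ t in (0 : ℝ)..y, a ⌈t⌉₊

lemma intervalIntegrable_comp_ceil {a : ℕ → ℂ} (ha : ∀ n, ‖a n‖ ≤ 1) (x y : ℝ) :
    IntervalIntegrable (fun t : ℝ => a ⌈t⌉₊) volume x y := by
  have hm : Measurable fun t : ℝ => a ⌈t⌉₊ :=
    (measurable_from_nat (f := a)).comp Nat.measurable_ceil
  refine (intervalIntegrable_const (c := (1 : ℝ))).mono_fun hm.aestronglyMeasurable ?_
  exact Filter.Eventually.of_forall fun t => by simpa using ha _

lemma norm_integral_comp_ceil_le {a : ℕ → ℂ} (ha : ∀ n, ‖a n‖ ≤ 1) (x y : ℝ) :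
    ‖∫ t in x..y, a ⌈t⌉₊‖ ≤ |y - x| := by
  simpa using intervalIntegral.norm_integral_le_of_norm_le_const (a := x) (b := y)
    (f := fun t : ℝ => a ⌈t⌉₊) (C := 1) fun t _ => ha _

lemma integral_comp_ceil_natCast {a : ℕ → ℂ} (ha : ∀ n, ‖a n‖ ≤ 1) (N : ℕ) :
    ∫ t in (0 : ℝ)..N, a ⌈t⌉₊ = ∑ n ∈ Icc 1 N, a n := by
  have h := intervalIntegral.sum_integral_adjacent_intervals (μ := volume)
    (f := fun t : ℝ => a ⌈t⌉₊) (a := fun k : ℕ => (k : ℝ)) (n := N)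
    fun k _ => intervalIntegrable_comp_ceil ha _ _
  simp only [Nat.cast_zero] at h
  rw [← h, ← Finset.Ico_add_one_right_eq_Icc, Finset.sum_Ico_eq_sum_range, Nat.add_sub_cancel]
  refine Finset.sum_congr rfl fun k _ => ?_
  rw [intervalIntegral.integral_congr_ae (g := fun _ => a (1 + k))]
  · simp
  · refine Eventually.of_forall fun t ht => ?_
    rw [Set.uIoc_of_le (by simp)] at ht
    have : ⌈t⌉₊ = k + 1 := by
      rw [Nat.ceil_eq_iff (by simp)]
      simpa using ht
    simp only [this, add_comm]

lemma norm_integral_comp_ceil_sub_sum_le {a : ℕ → ℂ} (ha : ∀ n, ‖a n‖ ≤ 1) {y : ℝ} (hy : 0 ≤ y) :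
    ‖(∫ t in (0 : ℝ)..y, a ⌈t⌉₊) - ∑ n ∈ Icc 1 ⌊y⌋₊, a n‖ ≤ 1 := by
  rw [← integral_comp_ceil_natCast ha, intervalIntegral.integral_interval_sub_left
    (intervalIntegrable_comp_ceil ha _ _) (intervalIntegrable_comp_ceil ha _ _)]
  refine (norm_integral_comp_ceil_le ha _ _).trans ?_
  rw [abs_of_nonneg (sub_nonneg.2 (Nat.floor_le hy))]
  linarith [Nat.lt_floor_add_one y]

lemma norm_contMean_le {a : ℕ → ℂ} (ha : ∀ n, ‖a n‖ ≤ 1) (y : ℝ) : ‖contMean a y‖ ≤ 1 := by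
  have h := norm_integral_comp_ceil_le ha 0 y
  rw [contMean, norm_mul, norm_inv, Complex.norm_real, Real.norm_eq_abs]
  rw [sub_zero] at h
  exact inv_mul_le_one_of_le₀ h (abs_nonneg y)

/-- This is the purpose of the interpolation: the mean becomes a Lipschitz function of `log y`, to
which Fourier analysis in the variable `log p` applies. -/
lemma norm_contMean_sub_le_of_le {a : ℕ → ℂ} (ha : ∀ n, ‖a n‖ ≤ 1) {y z : ℝ} (hy : 0 < y)
    (hyz : y ≤ z) : ‖contMean a y - contMean a z‖ ≤ 2 * (Real.log z - Real.log y) := by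
  have hz : 0 < z := hy.trans_le hyz
  have hyC : (y : ℂ) ≠ 0 := by exact_mod_cast hy.ne'
  have hzC : (z : ℂ) ≠ 0 := by exact_mod_cast hz.ne'
  have key : contMean a y - contMean a z =
      ((y⁻¹ - z⁻¹ : ℝ) : ℂ) * (∫ t in (0 : ℝ)..y, a ⌈t⌉₊) - (z : ℂ)⁻¹ * ∫ t in y..z, a ⌈t⌉₊ := by
    rw [contMean, contMean, ← intervalIntegral.integral_add_adjacent_intervals
      (intervalIntegrable_comp_ceil ha 0 y) (intervalIntegrable_comp_ceil ha y z)]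
    push_cast
    ring
  have hinv : 0 ≤ y⁻¹ - z⁻¹ := sub_nonneg.2 (inv_anti₀ hy hyz)
  have h1 := norm_integral_comp_ceil_le ha 0 y
  have h2 := norm_integral_comp_ceil_le ha y z
  rw [sub_zero, abs_of_pos hy] at h1
  rw [abs_of_nonneg (sub_nonneg.2 hyz)] at h2
  have hlog : 1 - y / z ≤ Real.log z - Real.log y := by
    have := Real.log_le_sub_one_of_pos (div_pos hy hz)
    rw [Real.log_div hy.ne' hz.ne'] at this
    linarith
  calc ‖contMean a y - contMean a z‖
      ≤ (y⁻¹ - z⁻¹) * y + z⁻¹ * (z - y) := by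
        rw [key]
        refine (norm_sub_le _ _).trans ?_
        rw [norm_mul, norm_mul, norm_inv, Complex.norm_real, Complex.norm_real,
          Real.norm_of_nonneg hinv, Real.norm_of_nonneg hz.le]
        gcongr
    _ = 2 * (1 - y / z) := by field_simp; ring
    _ ≤ _ := by linarith

lemma norm_contMean_sub_le {a : ℕ → ℂ} (ha : ∀ n, ‖a n‖ ≤ 1) {y z : ℝ} (hy : 0 < y)
    (hz : 0 < z) : ‖contMean a y - contMean a z‖ ≤ 2 * |Real.log y - Real.log z| := by
  rcases le_total y z with h | h
  · rw [abs_sub_comm]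
    exact (norm_contMean_sub_le_of_le ha hy h).trans (by gcongr; exact le_abs_self _)
  · rw [norm_sub_rev]
    exact (norm_contMean_sub_le_of_le ha hz h).trans (by gcongr; exact le_abs_self _)

/-- Second moment of a weighted count of prime divisors (Turán–Kubilius). -/
lemma sum_sq_weighted_primeDivisors_sub_le (P : Finset ℕ) (hP : ∀ p ∈ P, p.Prime) (c : ℕ → ℝ)
    (hc0 : ∀ p ∈ P, 0 ≤ c p) (hc1 : ∀ p ∈ P, c p ≤ 1) (N : ℕ) :
    ∑ n ∈ Icc 1 N, ((∑ p ∈ P, if p ∣ n then c p else 0) - ∑ p ∈ P, c p / p) ^ 2 ≤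
      N * (∑ p ∈ P, c p / p) + 2 * (∑ p ∈ P, c p / p) * #P := by
  set S := ∑ p ∈ P, c p / p with hS
  have hcard (d : ℕ) : (∑ n ∈ Icc 1 N, if d ∣ n then (1 : ℝ) else 0) = ((N / d : ℕ) : ℝ) := by
    rw [← Nat.Ioc_filter_dvd_card_eq_div, Finset.sum_boole]
    rfl
  have hS0 : 0 ≤ S := Finset.sum_nonneg fun p hp => div_nonneg (hc0 p hp) (Nat.cast_nonneg _)
  -- Expanding the square gives the first moment the coefficient `-2 * S`, so a lower bound is
  -- needed here and an upper bound for the second moment. Each floor loses at most 1, weighted by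
  -- `c p ≤ 1`.
  have h1 : (N : ℝ) * S - #P ≤ ∑ n ∈ Icc 1 N, ∑ p ∈ P, if p ∣ n then c p else 0 := by
    rw [Finset.sum_comm, hS, Finset.mul_sum, Finset.card_eq_sum_ones, Nat.cast_sum,
      ← Finset.sum_sub_distrib]
    refine Finset.sum_le_sum fun p hp => ?_
    have : (∑ n ∈ Icc 1 N, if p ∣ n then c p else 0) = c p * ((N / p : ℕ) : ℝ) := by
      rw [← hcard, Finset.mul_sum]
      simp
    rw [this]
    have h2 : (N : ℝ) / p ≤ ((N / p : ℕ) : ℝ) + 1 := by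
      rw [← Nat.floor_div_eq_div (K := ℝ)]
      exact (Nat.lt_floor_add_one _).le
    have := mul_le_mul_of_nonneg_left h2 (hc0 p hp)
    have h3 := hc1 p hp
    calc (N : ℝ) * (c p / p) - (1 : ℕ) = c p * (N / p) - 1 := by push_cast; ring
      _ ≤ _ := by linarith
  have h2 : ∑ n ∈ Icc 1 N, (∑ p ∈ P, if p ∣ n then c p else 0) ^ 2 ≤ N * S ^ 2 + N * S := by
    have e1 : ∑ n ∈ Icc 1 N, (∑ p ∈ P, if p ∣ n then c p else 0) ^ 2 =
        ∑ p ∈ P, ∑ r ∈ P, c p * c r * ∑ n ∈ Icc 1 N, if p ∣ n ∧ r ∣ n then (1 : ℝ) else 0 := by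
      simp_rw [sq, Finset.sum_mul_sum]
      rw [Finset.sum_comm]
      refine Finset.sum_congr rfl fun p _ => ?_
      rw [Finset.sum_comm]
      refine Finset.sum_congr rfl fun r _ => ?_
      rw [Finset.mul_sum]
      refine Finset.sum_congr rfl fun n _ => ?_
      by_cases h : p ∣ n <;> by_cases h' : r ∣ n <;> simp [h, h']
    have e2 : (N : ℝ) * S ^ 2 + N * S =
        ∑ p ∈ P, ∑ r ∈ P, (N * (c p / p * (c r / r)) + if p = r then N * (c p / p) else 0) := by
      simp_rw [Finset.sum_add_distrib, Finset.sum_ite_eq]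
      rw [sq, hS, Finset.sum_mul_sum, Finset.mul_sum, Finset.mul_sum]
      congr 1
      · exact Finset.sum_congr rfl fun p _ => by rw [Finset.mul_sum]
      · exact Finset.sum_congr rfl fun p hp => by simp [hp]
    rw [e1, e2]
    -- Off the diagonal, coprimality makes the densities multiply; on it, `c p ^ 2 ≤ c p` gives the
    -- extra `N * S`.
    refine Finset.sum_le_sum fun p hp => Finset.sum_le_sum fun r hr => ?_
    have hp0 : (0 : ℝ) < p := by exact_mod_cast (hP p hp).pos
    have hr0 : (0 : ℝ) < r := by exact_mod_cast (hP r hr).pos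
    have hcp := hc0 p hp
    have hcr := hc0 r hr
    by_cases hpr : p = r
    · subst hpr
      simp only [and_self, hcard, if_true]
      calc c p * c p * ((N / p : ℕ) : ℝ) ≤ c p * 1 * (N / p) := by
            gcongr
            · exact hc1 p hp
            · exact Nat.cast_div_le
        _ = N * (c p / p) := by ring
        _ ≤ _ := le_add_of_nonneg_left (by positivity)
    · have hco : Nat.Coprime p r := (Nat.coprime_primes (hP p hp) (hP r hr)).2 hpr
      have : ∀ n, (p ∣ n ∧ r ∣ n) ↔ p * r ∣ n := fun n =>
        ⟨fun h => hco.mul_dvd_of_dvd_of_dvd h.1 h.2,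
          fun h => ⟨dvd_of_mul_right_dvd h, dvd_of_mul_left_dvd h⟩⟩
      simp only [this, hcard, hpr, if_false, add_zero]
      calc c p * c r * ((N / (p * r) : ℕ) : ℝ) ≤ c p * c r * (N / ((p * r : ℕ) : ℝ)) := by
            gcongr
            exact Nat.cast_div_le
        _ = _ := by push_cast; field_simp
  have h3 : ∑ n ∈ Icc 1 N, ((∑ p ∈ P, if p ∣ n then c p else 0) - S) ^ 2 =
      ∑ n ∈ Icc 1 N, (∑ p ∈ P, if p ∣ n then c p else 0) ^ 2
        - 2 * S * (∑ n ∈ Icc 1 N, ∑ p ∈ P, if p ∣ n then c p else 0) + N * S ^ 2 := by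
    simp_rw [sub_sq, Finset.sum_add_distrib, Finset.sum_sub_distrib, Finset.mul_sum]
    simp only [sum_const, Nat.card_Icc, add_tsub_cancel_right, nsmul_eq_mul]
    congr 2
    refine Finset.sum_congr rfl fun n _ => ?_
    rw [Finset.sum_mul]
    exact Finset.sum_congr rfl fun p _ => by ring
  rw [h3]
  have := mul_le_mul_of_nonneg_left h1 (by positivity : 0 ≤ 2 * S)
  linarith

lemma sum_filter_dvd_eq {p : ℕ} (hp : 0 < p) (a : ℕ → ℂ) (N : ℕ) :
    (∑ n ∈ Icc 1 N, if p ∣ n then a n else 0) = ∑ m ∈ Icc 1 (N / p), a (p * m) := by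
  rw [← Finset.sum_filter]
  symm
  refine Finset.sum_bij (fun m _ => p * m) ?_ ?_ ?_ fun _ _ => rfl
  · intro m hm
    simp only [mem_Icc, mem_filter] at hm ⊢
    refine ⟨⟨Nat.mul_pos hp hm.1, ?_⟩, dvd_mul_right _ _⟩
    rw [mul_comm]
    exact (Nat.le_div_iff_mul_le hp).1 hm.2
  · intro m _ m' _ h
    exact Nat.eq_of_mul_eq_mul_left hp h
  · intro n hn
    simp only [mem_Icc, mem_filter] at hn
    obtain ⟨⟨h1, h2⟩, m, rfl⟩ := hn
    refine ⟨m, ?_, rfl⟩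
    rw [mem_Icc, Nat.le_div_iff_mul_le hp, mul_comm m]
    exact ⟨Nat.pos_of_mul_pos_left h1, h2⟩

/-- The mean of `a` is close to a weighted average of means along multiples of primes. -/
theorem eventually_norm_contMean_sub_prime_average_le (P : Finset ℕ) (hP : ∀ p ∈ P, p.Prime)
    (c : ℕ → ℝ) (hc0 : ∀ p ∈ P, 0 ≤ c p) (hc1 : ∀ p ∈ P, c p ≤ 1) {a b : ℕ → ℂ}
    (ha : ∀ n, ‖a n‖ ≤ 1) (hb : ∀ n, ‖b n‖ ≤ 1)
    (hab : ∀ p ∈ P, ∀ m, 1 ≤ m → a (p * m) = b m) :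
    ∀ᶠ y : ℝ in atTop, ‖((∑ p ∈ P, c p / p : ℝ) : ℂ) * contMean a y
      - ∑ p ∈ P, ((c p / p : ℝ) : ℂ) * contMean b (y / p)‖ ≤ √(∑ p ∈ P, c p / p) + 1 := by
  set S := ∑ p ∈ P, c p / p with hS
  have hS0 : 0 ≤ S := Finset.sum_nonneg fun p hp => div_nonneg (hc0 p hp) (Nat.cast_nonneg _)
  have hbound : ∀ y : ℝ, 1 ≤ y → ‖(S : ℂ) * contMean a y
      - ∑ p ∈ P, ((c p / p : ℝ) : ℂ) * contMean b (y / p)‖ ≤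
        √(S + 2 * S * #P * y⁻¹) + (S + #P) * y⁻¹ := by
    intro y hy
    have hy0 : 0 < y := by linarith
    set N := ⌊y⌋₊ with hN
    have hNy : (N : ℝ) ≤ y := Nat.floor_le hy0.le
    set W : ℕ → ℝ := fun n => (∑ p ∈ P, if p ∣ n then c p else 0) - S with hW
    -- Two interpolation errors, bounded by S and `#P`, and a correlation of `a` with the centred
    -- divisor count `W`, left to Cauchy–Schwarz.
    have hsplit : (S : ℂ) * contMean a y - ∑ p ∈ P, ((c p / p : ℝ) : ℂ) * contMean b (y / p) =
        (y : ℂ)⁻¹ * ((S : ℂ) * ((∫ t in (0 : ℝ)..y, a ⌈t⌉₊) - ∑ n ∈ Icc 1 N, a n)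
          - ∑ p ∈ P, (c p : ℂ) * ((∫ t in (0 : ℝ)..(y / p), b ⌈t⌉₊)
              - ∑ m ∈ Icc 1 ⌊y / p⌋₊, b m)
          - ∑ n ∈ Icc 1 N, (W n : ℂ) * a n) := by
      have e1 : ∑ n ∈ Icc 1 N, (W n : ℂ) * a n =
          ∑ p ∈ P, (c p : ℂ) * ∑ m ∈ Icc 1 ⌊y / p⌋₊, b m - S * ∑ n ∈ Icc 1 N, a n := by
        have : ∀ n, (W n : ℂ) * a n =
            (∑ p ∈ P, (c p : ℂ) * if p ∣ n then a n else 0) - S * a n := by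
          intro n
          simp only [hW, Complex.ofReal_sub, Complex.ofReal_sum, sub_mul, Finset.sum_mul]
          congr 1
          refine Finset.sum_congr rfl fun p _ => ?_
          split_ifs <;> simp
        simp_rw [this, Finset.sum_sub_distrib, ← Finset.mul_sum]
        rw [Finset.sum_comm]
        congr 1
        refine Finset.sum_congr rfl fun p hp => ?_
        rw [← Finset.mul_sum, sum_filter_dvd_eq (hP p hp).pos, Nat.floor_div_natCast]
        congr 1
        exact Finset.sum_congr rfl fun m hm => hab p hp m (mem_Icc.1 hm).1
      have e2 : ∑ p ∈ P, ((c p / p : ℝ) : ℂ) * contMean b (y / p) =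
          (y : ℂ)⁻¹ * ∑ p ∈ P, (c p : ℂ) * ∫ t in (0 : ℝ)..(y / p), b ⌈t⌉₊ := by
        rw [Finset.mul_sum]
        refine Finset.sum_congr rfl fun p hp => ?_
        have hp0 : (p : ℂ) ≠ 0 := by exact_mod_cast (hP p hp).ne_zero
        have hyC : (y : ℂ) ≠ 0 := by exact_mod_cast hy0.ne'
        rw [contMean]
        push_cast
        field_simp
      rw [e1, e2, contMean]
      simp_rw [mul_sub, Finset.sum_sub_distrib]
      ring
    have hCS : ‖∑ n ∈ Icc 1 N, (W n : ℂ) * a n‖ ≤ y * √(S + 2 * S * #P * y⁻¹) := by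
      calc ‖∑ n ∈ Icc 1 N, (W n : ℂ) * a n‖ ≤ ∑ n ∈ Icc 1 N, |W n| * 1 := by
            refine (norm_sum_le _ _).trans (Finset.sum_le_sum fun n _ => ?_)
            rw [norm_mul, Complex.norm_real, Real.norm_eq_abs]
            gcongr
            exact ha n
        _ ≤ √(∑ n ∈ Icc 1 N, |W n| ^ 2) * √(∑ n ∈ Icc 1 N, (1 : ℝ) ^ 2) :=
            Real.sum_mul_le_sqrt_mul_sqrt _ _ _
        _ ≤ √(y * S + 2 * S * #P) * √y := by
            simp only [sq_abs]
            gcongr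
            · refine (sum_sq_weighted_primeDivisors_sub_le P hP c hc0 hc1 N).trans ?_
              rw [← hS]
              gcongr
            · simpa using hNy
        _ = y * √(S + 2 * S * #P * y⁻¹) := by
            have : y * S + 2 * S * #P = y * (S + 2 * S * #P * y⁻¹) := by field_simp
            rw [this, Real.sqrt_mul hy0.le, mul_right_comm, Real.mul_self_sqrt hy0.le]
    have h2 : ‖∑ p ∈ P, (c p : ℂ) * ((∫ t in (0 : ℝ)..(y / p), b ⌈t⌉₊)
              - ∑ m ∈ Icc 1 ⌊y / p⌋₊, b m)‖ ≤ #P := by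
      rw [Finset.card_eq_sum_ones, Nat.cast_sum]
      refine (norm_sum_le _ _).trans (Finset.sum_le_sum fun p hp => ?_)
      rw [norm_mul, Complex.norm_real, Real.norm_of_nonneg (hc0 p hp), Nat.cast_one]
      exact mul_le_one₀ (hc1 p hp) (norm_nonneg _)
        (norm_integral_comp_ceil_sub_sum_le hb (by positivity))
    have h1 : ‖(S : ℂ) * ((∫ t in (0 : ℝ)..y, a ⌈t⌉₊) - ∑ n ∈ Icc 1 N, a n)‖ ≤ S := by
      rw [norm_mul, Complex.norm_real, Real.norm_of_nonneg hS0]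
      exact mul_le_of_le_one_right hS0 (norm_integral_comp_ceil_sub_sum_le ha hy0.le)
    rw [hsplit, norm_mul, norm_inv, Complex.norm_real, Real.norm_of_nonneg hy0.le]
    calc y⁻¹ * _ ≤ y⁻¹ * (S + #P + y * √(S + 2 * S * #P * y⁻¹)) := by
          gcongr
          refine (norm_sub_le _ _).trans (add_le_add ((norm_sub_le _ _).trans ?_) hCS)
          exact add_le_add h1 h2
      _ = _ := by field_simp; ring
  -- The set `P` stays fixed as `y` grows, so only `√S` survives.
  have hlim : Tendsto (fun y : ℝ => √(S + 2 * S * #P * y⁻¹) + (S + #P) * y⁻¹) atTop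
      (𝓝 (√(S + 2 * S * #P * 0) + (S + #P) * 0)) :=
    ((tendsto_const_nhds.add (tendsto_inv_atTop_zero.const_mul _)).sqrt).add
      (tendsto_inv_atTop_zero.const_mul _)
  filter_upwards [hlim.eventually_le_const (u := √S + 1) (by simp), eventually_ge_atTop 1]
    with y h1 h2
  exact (hbound y h2).trans h1

end

/-! ### Fourier duality: from bounded exponential sums to Lipschitz test functions -/

section

open Finset Filter Topology MeasureTheory SchwartzMap FourierTransform

/-- Exponential sums `∑ wᵢ e(t xᵢ)` that are bounded on the support of `k` make the corresponding
sums of translates of `𝓕⁻ k` small in `L²`. -/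
lemma integral_norm_sq_sum_fourierInv_sub_le {ι : Type*} (s : Finset ι) (w : ι → ℂ) (x : ι → ℝ)
    (k : 𝓢(ℝ, ℂ)) (hk : HasCompactSupport k) {M : ℝ}
    (hM : ∀ t, k t ≠ 0 → ‖∑ i ∈ s, w i * Complex.exp ((2 * Real.pi * (t * x i) : ℝ) * Complex.I)‖ ≤ M) :
    Integrable (fun v => ‖∑ i ∈ s, w i * (𝓕⁻ k) (x i - v)‖ ^ 2) ∧
    ∫ v, ‖∑ i ∈ s, w i * (𝓕⁻ k) (x i - v)‖ ^ 2 ≤ M ^ 2 * ∫ t, ‖k t‖ ^ 2 := by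
  set Z : ℝ → ℂ :=
    fun t => ∑ i ∈ s, w i * Complex.exp ((2 * Real.pi * (t * x i) : ℝ) * Complex.I) with hZ
  have hsmooth : ContDiff ℝ (⊤ : ℕ∞) fun t => Z t * k t := by
    refine ContDiff.mul ?_ (k.smooth _)
    refine ContDiff.sum fun i _ => contDiff_const.mul ?_
    refine ContDiff.cexp (ContDiff.mul ?_ contDiff_const)
    exact Complex.ofRealCLM.contDiff.comp (contDiff_const.mul (contDiff_id.mul contDiff_const))
  have hsupp : HasCompactSupport fun t => Z t * k t := hk.mul_left
  set K : 𝓢(ℝ, ℂ) := hsupp.toSchwartzMap hsmooth with hK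
  have hKt : ∀ t, K t = Z t * k t := fun t => rfl
  -- The sum of translates is the Fourier transform of the Schwartz function `Z * k`, so Plancherel
  -- moves the estimate to the support of `k`.
  have hF : ∀ v, ∑ i ∈ s, w i * (𝓕⁻ k) (x i - v) = (𝓕 K) v := by
    intro v
    rw [fourier_coe, Real.fourier_eq']
    simp_rw [hKt, hZ, Finset.sum_mul, smul_eq_mul, Finset.mul_sum]
    rw [integral_finsetSum]
    · refine Finset.sum_congr rfl fun i _ => ?_
      rw [fourierInv_coe, Real.fourierInv_eq', ← integral_const_mul]
      refine integral_congr_ae (Eventually.of_forall fun t => ?_)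
      simp only [smul_eq_mul, RCLike.inner_apply, conj_trivial]
      rw [show (((2 * Real.pi * ((x i - v) * t) : ℝ) : ℂ) * Complex.I) =
        ((-2 * Real.pi * (v * t) : ℝ) : ℂ) * Complex.I
          + ((2 * Real.pi * (t * x i) : ℝ) : ℂ) * Complex.I by push_cast; ring, Complex.exp_add]
      ring
    · intro i _
      refine (k.integrable.norm.const_mul ‖w i‖).mono' ?_ (Eventually.of_forall fun t => ?_)
      · have := k.continuous
        exact Continuous.aestronglyMeasurable (by fun_prop)
      · simp only [norm_mul, Complex.norm_exp_ofReal_mul_I, one_mul, mul_one, le_refl]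
  simp_rw [hF]
  refine ⟨((𝓕 K).memLp 2).integrable_norm_pow two_ne_zero, ?_⟩
  rw [integral_norm_sq_fourier, ← integral_const_mul]
  refine integral_mono ((K.memLp 2).integrable_norm_pow two_ne_zero)
    (((k.memLp 2).integrable_norm_pow two_ne_zero).const_mul _) fun t => ?_
  simp only [hKt, norm_mul, mul_pow]
  by_cases h : k t = 0
  · simp [h]
  · gcongr
    exact hM t h

/-- The duality form of the previous estimate. -/
lemma norm_sum_integral_mul_fourierInv_le {ι : Type*} (s : Finset ι) (w : ι → ℂ) (x : ι → ℝ)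
    (k : 𝓢(ℝ, ℂ)) (hk : HasCompactSupport k) {M : ℝ} (hM0 : 0 ≤ M)
    (hM : ∀ t, k t ≠ 0 → ‖∑ i ∈ s, w i * Complex.exp ((2 * Real.pi * (t * x i) : ℝ) * Complex.I)‖ ≤ M)
    (h : ℝ → ℂ) (hh : MemLp h 2) :
    ‖∑ i ∈ s, w i * ∫ v, h v * (𝓕⁻ k) (x i - v)‖ ≤
      √(∫ v, ‖h v‖ ^ 2) * (M * √(∫ t, ‖k t‖ ^ 2)) := by
  obtain ⟨hint, hle⟩ := integral_norm_sq_sum_fourierInv_sub_le s w x k hk hM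
  have hφ (i : ι) : MemLp (fun v => (𝓕⁻ k) (x i - v)) 2 :=
    ((𝓕⁻ k).memLp 2).comp_measurePreserving (Measure.measurePreserving_sub_left volume (x i))
  have hsum : MemLp (fun v => ∑ i ∈ s, w i * (𝓕⁻ k) (x i - v)) 2 :=
    memLp_finsetSum _ fun i _ => (hφ i).const_mul _
  have e : ∑ i ∈ s, w i * ∫ v, h v * (𝓕⁻ k) (x i - v) =
      ∫ v, h v * ∑ i ∈ s, w i * (𝓕⁻ k) (x i - v) := by
    simp_rw [Finset.mul_sum]
    rw [integral_finsetSum]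
    · refine Finset.sum_congr rfl fun i _ => ?_
      rw [← integral_const_mul]
      congr with v
      ring
    · intro i _
      exact hh.integrable_mul ((hφ i).const_mul _)
  rw [e]
  refine (norm_integral_le_integral_norm _).trans ?_
  simp_rw [norm_mul]
  have := integral_mul_norm_le_Lp_mul_Lq (μ := (volume : Measure ℝ)) Real.HolderConjugate.two_two
    (f := h) (g := fun v => ∑ i ∈ s, w i * (𝓕⁻ k) (x i - v)) (by simpa using hh)
    (by simpa using hsum)
  simp only [Real.rpow_two, ← Real.sqrt_eq_rpow] at this
  refine this.trans ?_
  gcongr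
  calc _ ≤ √(M ^ 2 * ∫ t, ‖k t‖ ^ 2) := Real.sqrt_le_sqrt hle
    _ = _ := by rw [Real.sqrt_mul (sq_nonneg M), Real.sqrt_sq hM0]

/-- If `∑ wᵢ e(t xᵢ)` is bounded by `M` for `|t| ≤ R`, then sums `∑ wᵢ h(xᵢ)` are controlled by
`M` times the `L²` norm of `h` and `R⁻¹` times a modulus of continuity of `h`. -/
theorem exists_norm_sum_le_of_exponential_sum_bounded :
    ∃ A : ℝ, 0 ≤ A ∧ ∀ R : ℝ, 0 < R → ∀ {ι : Type} (s : Finset ι) (w : ι → ℂ) (x : ι → ℝ) (M : ℝ),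
      0 ≤ M →
      (∀ t, |t| ≤ R → ‖∑ i ∈ s, w i * Complex.exp ((t * x i : ℝ) * Complex.I)‖ ≤ M) →
      ∀ (h : ℝ → ℂ), MemLp h 2 → Continuous h → ∀ (m : ℝ → ℝ),
      (∀ u v, ‖h u - h v‖ ≤ m u * |u - v|) →
      ‖∑ i ∈ s, w i * h (x i)‖ ≤
        A * √R * M * √(∫ v, ‖h v‖ ^ 2) + A / R * ∑ i ∈ s, ‖w i‖ * m (x i) := by
  -- The outer radius 1/8 ensures `2 * π * |t| ≤ 1` on the support, from `π ≤ 4`. The value 1 at the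
  -- origin gives `φ` integral 1, so it serves as an approximate identity.
  let β : ContDiffBump (0 : ℝ) := ⟨1 / 16, 1 / 8, by norm_num, by norm_num⟩
  have hsm : ContDiff ℝ (⊤ : ℕ∞) fun t : ℝ => ((β t : ℝ) : ℂ) :=
    Complex.ofRealCLM.contDiff.comp β.contDiff
  have hcs : HasCompactSupport fun t : ℝ => ((β t : ℝ) : ℂ) :=
    β.hasCompactSupport.comp_left Complex.ofReal_zero
  let k : 𝓢(ℝ, ℂ) := hcs.toSchwartzMap hsm
  have hk : HasCompactSupport k := hcs
  have hkt (t : ℝ) (ht : k t ≠ 0) : |t| ≤ 1 / 8 := by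
    have h1 : β t ≠ 0 := fun h => ht (by change ((β t : ℝ) : ℂ) = 0; simp [h])
    have h2 : t ∈ Function.support β := h1
    rw [β.support_eq] at h2
    simpa [β] using (Metric.mem_ball.1 h2).le
  set φ : 𝓢(ℝ, ℂ) := 𝓕⁻ k with hφ
  have hφ1 : ∫ v, φ v = 1 := by
    have h1 : (𝓕 φ) 0 = k 0 := by rw [hφ, FourierTransform.fourier_fourierInv_eq]
    rw [fourier_coe, Real.fourier_eq'] at h1
    have h2 : k 0 = 1 := by
      change ((β 0 : ℝ) : ℂ) = 1
      rw [β.one_of_mem_closedBall (by simp [β])]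
      simp
    simpa [h2] using h1
  have hφi : Integrable fun v : ℝ => |v| * ‖φ v‖ := by
    simpa using φ.integrable_pow_mul volume 1
  set κ := ∫ v, |v| * ‖φ v‖ with hκ
  have hκ0 : 0 ≤ κ := integral_nonneg fun v => by positivity
  refine ⟨√(∫ t, ‖k t‖ ^ 2) + κ, by positivity, ?_⟩
  intro R hR ι s w x M hM0 hM h hh hcont m hm
  -- Stretching `h` by R amounts to smoothing it at scale `1 / R`; its `L²` norm grows by `√R`.
  set h' : ℝ → ℂ := fun v => h (v / R) with hh'
  have hmp : ∫ v, ‖h' v‖ ^ 2 = R * ∫ v, ‖h v‖ ^ 2 := by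
    have := Measure.integral_comp_div (fun v => ‖h v‖ ^ 2) R
    rw [abs_of_pos hR, smul_eq_mul] at this
    exact this
  have hh'2 : MemLp h' 2 := by
    rw [memLp_two_iff_integrable_sq_norm (by fun_prop)] at hh ⊢
    exact hh.comp_div hR.ne'
  have h1 : ‖∑ i ∈ s, w i * ∫ v, h' v * φ (R * x i - v)‖ ≤
      √(∫ v, ‖h' v‖ ^ 2) * (M * √(∫ t, ‖k t‖ ^ 2)) := by
    refine norm_sum_integral_mul_fourierInv_le s w (fun i => R * x i) k hk hM0 (fun t ht => ?_)
      h' hh'2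
    have ht' := hkt t ht
    have := hM (2 * Real.pi * t * R) (by
      rw [abs_mul, abs_mul, abs_of_pos hR, abs_of_pos Real.two_pi_pos]
      have h3 := Real.pi_le_four
      have : 2 * Real.pi * |t| ≤ 1 := by
        calc 2 * Real.pi * |t| ≤ 2 * 4 * (1 / 8) := by gcongr
          _ = 1 := by norm_num
      nlinarith)
    simpa only [mul_assoc] using this
  -- The smoothing error is the modulus of continuity at `u` times the first absolute moment `κ` of
  -- `φ`, scaled by `1 / R`.
  have hsmooth (u : ℝ) : ‖h u - ∫ v, h' v * φ (R * u - v)‖ ≤ κ / R * m u := by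
    have hb : ∀ v, ‖(h u - h (u - v / R)) * φ v‖ ≤ m u / R * (|v| * ‖φ v‖) := by
      intro v
      rw [norm_mul]
      have := hm u (u - v / R)
      rw [sub_sub_cancel, abs_div, abs_of_pos hR] at this
      calc ‖h u - h (u - v / R)‖ * ‖φ v‖ ≤ (m u * (|v| / R)) * ‖φ v‖ := by gcongr
        _ = _ := by ring
    have hi : Integrable fun v => (h u - h (u - v / R)) * φ v := by
      refine (hφi.const_mul (m u / R)).mono' ?_ (Eventually.of_forall hb)
      have := φ.continuous
      exact Continuous.aestronglyMeasurable (by fun_prop)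
    have e1 : ∫ v, h' v * φ (R * u - v) = ∫ v, h (u - v / R) * φ v := by
      rw [← integral_sub_left_eq_self (fun v => h' v * φ (R * u - v)) volume (R * u)]
      congr with v
      simp only [hh', sub_sub_cancel, sub_div, mul_div_cancel_left₀ _ hR.ne']
    have e2 : h u = ∫ v, h u * φ v := by rw [integral_const_mul, hφ1, mul_one]
    have hi2 : Integrable fun v => h u * φ v := φ.integrable.const_mul _
    have hi3 : Integrable fun v => h (u - v / R) * φ v := by
      refine (hi2.sub hi).congr (Eventually.of_forall fun v => ?_)
      simp only [Pi.sub_apply]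
      ring
    rw [e1]
    nth_rewrite 1 [e2]
    rw [← integral_sub hi2 hi3]
    simp_rw [← sub_mul]
    refine (norm_integral_le_integral_norm _).trans ?_
    refine (integral_mono hi.norm (hφi.const_mul _) hb).trans_eq ?_
    rw [integral_const_mul, ← hκ]
    ring
  have hm0 (u : ℝ) : 0 ≤ m u := by
    have := (norm_nonneg _).trans (hm u (u + 1))
    simpa using this
  have e : ∑ i ∈ s, w i * h (x i) = (∑ i ∈ s, w i * ∫ v, h' v * φ (R * x i - v))
      + ∑ i ∈ s, w i * (h (x i) - ∫ v, h' v * φ (R * x i - v)) := by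
    rw [← Finset.sum_add_distrib]
    exact Finset.sum_congr rfl fun i _ => by ring
  rw [e]
  refine (norm_add_le _ _).trans (add_le_add (h1.trans ?_) ?_)
  · rw [hmp, Real.sqrt_mul hR.le]
    calc _ = √(∫ t, ‖k t‖ ^ 2) * √R * M * √(∫ v, ‖h v‖ ^ 2) := by ring
      _ ≤ _ := by
        gcongr
        exact le_add_of_nonneg_right hκ0
  · rw [Finset.mul_sum]
    refine (norm_sum_le _ _).trans (Finset.sum_le_sum fun i _ => ?_)
    rw [norm_mul]
    calc ‖w i‖ * _ ≤ ‖w i‖ * (κ / R * m (x i)) := by gcongr; exact hsmooth _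
      _ = κ / R * (‖w i‖ * m (x i)) := by ring
      _ ≤ _ := by
        have := hm0 (x i)
        gcongr
        exact le_add_of_nonneg_left (Real.sqrt_nonneg _)

end

/-! ### Shift invariance for von Mangoldt weights -/

section

open Finset Filter Topology MeasureTheory ArithmeticFunction ArithmeticFunction.vonMangoldt

lemma residueClass_zmod_one (n : ℕ) : residueClass (1 : ZMod 1) n = vonMangoldt n := by
  simp only [residueClass]
  rw [Set.indicator_of_mem]
  exact Subsingleton.elim _ _

/-- The factor `1 - q ^ (i t)` cancels the pole of `ζ'/ζ` at `s = 1`, and `ζ` has no zeros with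
`re s = 1`. -/
lemma exists_norm_one_sub_exp_mul_LSeries_vonMangoldt_le (R s : ℝ) :
    ∃ M : ℝ, 0 ≤ M ∧ ∀ σ : ℝ, 0 < σ → σ ≤ 1 → ∀ t : ℝ, |t| ≤ R →
      ‖(1 - Complex.exp ((t * s : ℝ) * Complex.I)) *
        LSeries (fun n => (vonMangoldt n : ℂ)) (1 + σ - t * Complex.I)‖ ≤ M := by
  -- For modulus 1 this function is the continuous extension of `-ζ'/ζ(s) - 1 / (s - 1)` to Re s ≥
  -- 1; nonvanishing of ζ on the boundary line enters here.
  have hcont := continuousOn_LFunctionResidueClassAux (1 : ZMod 1)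
  have heq := eqOn_LFunctionResidueClassAux (isUnit_one (M := ZMod 1))
  set G := LFunctionResidueClassAux (1 : ZMod 1) with hG
  have hcomp : IsCompact (Set.Icc (0 : ℝ) 1 ×ˢ Set.Icc (-R) R) := isCompact_Icc.prod isCompact_Icc
  have hGc : ContinuousOn (fun z : ℝ × ℝ => G (1 + z.1 - z.2 * Complex.I))
      (Set.Icc (0 : ℝ) 1 ×ˢ Set.Icc (-R) R) := by
    refine hcont.comp (by fun_prop) fun z hz => ?_
    simpa using hz.1.1
  obtain ⟨C, hC⟩ := hcomp.exists_bound_of_continuousOn hGc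
  refine ⟨2 * |C| + |s|, by positivity, fun σ h0 h1 t ht => ?_⟩
  set z : ℂ := 1 + σ - t * Complex.I with hz
  have hre : 1 < z.re := by simpa [hz] using h0
  have hL : LSeries (fun n => (vonMangoldt n : ℂ)) z = G z + 1 / (z - 1) := by
    have := heq (show z ∈ {s : ℂ | 1 < s.re} from hre)
    simp only [residueClass_zmod_one, Nat.totient_one, Nat.cast_one, inv_one] at this
    rw [this]
    ring
  have hGz : ‖G z‖ ≤ |C| := (hC (σ, t) ⟨⟨h0.le, h1⟩, abs_le.1 ht⟩).trans (le_abs_self C)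
  have he2 : ‖1 - Complex.exp ((t * s : ℝ) * Complex.I)‖ ≤ 2 := by
    refine (norm_sub_le _ _).trans ?_
    rw [Complex.norm_exp_ofReal_mul_I, norm_one]
    norm_num
  have he1 : ‖1 - Complex.exp ((t * s : ℝ) * Complex.I)‖ ≤ |t| * |s| := by
    rw [norm_sub_rev, mul_comm _ Complex.I, ← abs_mul]
    exact Real.norm_exp_I_mul_ofReal_sub_one_le
  have hz1 : |t| ≤ ‖z - 1‖ := by
    have := Complex.abs_im_le_norm (z - 1)
    simpa [hz] using this
  have hz0 : 0 < ‖z - 1‖ := by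
    rw [norm_pos_iff]
    intro h
    have := congrArg Complex.re h
    simp [hz] at this
    linarith
  rw [hL, mul_add]
  refine (norm_add_le _ _).trans (add_le_add ?_ ?_)
  · rw [norm_mul]
    gcongr
  · rw [norm_mul, norm_div, norm_one, mul_one_div, div_le_iff₀ hz0]
    calc _ ≤ |t| * |s| := he1
      _ ≤ ‖z - 1‖ * |s| := by gcongr
      _ = _ := mul_comm _ _

/-- The weight `Λ(n) / n ^ (1 + σ)`. -/
noncomputable def mangoldtWeight (σ : ℝ) (n : ℕ) : ℝ := vonMangoldt n * (n : ℝ) ^ (-(1 + σ))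

lemma mangoldtWeight_nonneg (σ : ℝ) (n : ℕ) : 0 ≤ mangoldtWeight σ n :=
  mul_nonneg vonMangoldt_nonneg (by positivity)

lemma mangoldtWeight_le {σ : ℝ} (hσ : 0 ≤ σ) (n : ℕ) :
    mangoldtWeight σ n ≤ vonMangoldt n / n := by
  rcases Nat.eq_zero_or_pos n with rfl | hn
  · simp [mangoldtWeight]
  · rw [mangoldtWeight, div_eq_mul_inv, ← Real.rpow_neg_one]
    have h1 : (1 : ℝ) ≤ n := by exact_mod_cast hn
    exact mul_le_mul_of_nonneg_left (Real.rpow_le_rpow_of_exponent_le h1 (by linarith))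
      vonMangoldt_nonneg

lemma LSeries_term_vonMangoldt_eq (σ t : ℝ) (n : ℕ) :
    LSeries.term (fun n => (vonMangoldt n : ℂ)) (1 + σ - t * Complex.I) n =
      (mangoldtWeight σ n : ℂ) * Complex.exp ((t * Real.log n : ℝ) * Complex.I) := by
  rcases Nat.eq_zero_or_pos n with rfl | hn
  · simp [mangoldtWeight]
  · have hn0 : (n : ℂ) ≠ 0 := by exact_mod_cast hn.ne'
    rw [LSeries.term_of_ne_zero hn.ne', mangoldtWeight, div_eq_mul_inv, ← Complex.cpow_neg,
      Complex.ofReal_mul, Complex.ofReal_cpow (by positivity), mul_assoc]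
    congr 1
    rw [Complex.ofReal_natCast, Complex.cpow_def_of_ne_zero hn0, Complex.cpow_def_of_ne_zero hn0,
      ← Complex.exp_add, ← Complex.natCast_log]
    congr 1
    push_cast
    ring

lemma summable_mangoldtWeight {σ : ℝ} (hσ : 0 < σ) : Summable (mangoldtWeight σ) := by
  have h : LSeriesSummable (fun n => (vonMangoldt n : ℂ)) (1 + σ - (0 : ℝ) * Complex.I) :=
    LSeriesSummable_vonMangoldt (by simpa using hσ)
  have h' := h.norm
  refine h'.congr fun n => ?_
  rw [LSeries_term_vonMangoldt_eq]
  simp [abs_of_nonneg (mangoldtWeight_nonneg σ n)]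

/-- For `X` large in terms of `σ` the tail of the weights is at most 1, so truncating the series
costs at most 2. The bound `M` is uniform in `σ`; only the truncation point depends on it. -/
lemma exists_eventually_norm_sum_mangoldtWeight_exp_le (R s : ℝ) :
    ∃ M : ℝ, 0 ≤ M ∧ ∀ σ : ℝ, 0 < σ → σ ≤ 1 → ∀ᶠ X : ℕ in atTop, ∀ t : ℝ, |t| ≤ R →
      ‖∑ n ∈ range X, (mangoldtWeight σ n : ℂ) *
        (Complex.exp ((t * Real.log n : ℝ) * Complex.I)
          - Complex.exp ((t * (Real.log n + s) : ℝ) * Complex.I))‖ ≤ M := by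
  obtain ⟨M, hM0, hM⟩ := exists_norm_one_sub_exp_mul_LSeries_vonMangoldt_le R s
  refine ⟨M + 2, by positivity, fun σ h0 h1 => ?_⟩
  have hsum := summable_mangoldtWeight h0
  have htail := tendsto_sum_nat_add (mangoldtWeight σ)
  filter_upwards [htail.eventually_le_const (zero_lt_one (α := ℝ))] with X hX t ht
  have hs : LSeriesSummable (fun n => (vonMangoldt n : ℂ)) (1 + σ - t * Complex.I) :=
    LSeriesSummable_vonMangoldt (by simpa using h0)
  set E : ℂ := 1 - Complex.exp ((t * s : ℝ) * Complex.I) with hE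
  set T := LSeries.term (fun n => (vonMangoldt n : ℂ)) (1 + σ - t * Complex.I) with hT
  have e1 : ∑ n ∈ range X, (mangoldtWeight σ n : ℂ) *
        (Complex.exp ((t * Real.log n : ℝ) * Complex.I)
          - Complex.exp ((t * (Real.log n + s) : ℝ) * Complex.I)) = E * ∑ n ∈ range X, T n := by
    rw [Finset.mul_sum]
    refine Finset.sum_congr rfl fun n _ => ?_
    rw [hT, LSeries_term_vonMangoldt_eq, mul_add t, Complex.ofReal_add, add_mul, Complex.exp_add]
    ring
  have e2 : ∑ n ∈ range X, T n = LSeries (fun n => (vonMangoldt n : ℂ)) (1 + σ - t * Complex.I)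
      - ∑' n, T (n + X) := by
    rw [eq_sub_iff_add_eq]
    exact hs.sum_add_tsum_nat_add X
  have htl : ‖∑' n, T (n + X)‖ ≤ 1 := by
    refine (tsum_of_norm_bounded ((summable_nat_add_iff X).2 hsum).hasSum fun n => ?_).trans hX
    rw [hT, LSeries_term_vonMangoldt_eq, norm_mul, Complex.norm_exp_ofReal_mul_I, mul_one,
      Complex.norm_real, Real.norm_of_nonneg (mangoldtWeight_nonneg _ _)]
  have hE2 : ‖E‖ ≤ 2 := by
    refine (norm_sub_le _ _).trans ?_
    rw [Complex.norm_exp_ofReal_mul_I, norm_one]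
    norm_num
  rw [e1, e2, mul_sub]
  refine (norm_sub_le _ _).trans (add_le_add (hM σ h0 h1 t ht) ?_)
  rw [norm_mul]
  calc ‖E‖ * _ ≤ 2 * 1 := by gcongr
    _ = 2 := by norm_num

/-- Dividing by `1 + |u|` puts `g` in `L²`, and the Lipschitz modulus keeps the same decay. The
error term of the duality bound is therefore proportional to the total mass of the weights. -/
lemma norm_div_one_add_abs_sub_le {g : ℝ → ℂ} (hg1 : ∀ u, ‖g u‖ ≤ 1)
    (hg2 : ∀ u v, ‖g u - g v‖ ≤ 2 * |u - v|) (u v : ℝ) :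
    ‖g u / (1 + |u| : ℝ) - g v / (1 + |v| : ℝ)‖ ≤ 3 / (1 + |u|) * |u - v| := by
  have hu : 0 < 1 + |u| := by positivity
  have hv : 0 < 1 + |v| := by positivity
  have huC : ((1 + |u| : ℝ) : ℂ) ≠ 0 := by exact_mod_cast hu.ne'
  have hvC : ((1 + |v| : ℝ) : ℂ) ≠ 0 := by exact_mod_cast hv.ne'
  have e : g u / (1 + |u| : ℝ) - g v / (1 + |v| : ℝ) =
      ((g u - g v) + g v * (((|v| - |u|) / (1 + |v|) : ℝ) : ℂ)) / (1 + |u| : ℝ) := by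
    rw [Complex.ofReal_div, eq_div_iff huC]
    field_simp
    push_cast
    ring
  rw [e, norm_div, Complex.norm_real, Real.norm_of_nonneg hu.le, div_mul_eq_mul_div]
  gcongr
  refine (norm_add_le _ _).trans ?_
  have h2 : ‖g v * (((|v| - |u|) / (1 + |v|) : ℝ) : ℂ)‖ ≤ 1 * |u - v| := by
    rw [norm_mul]
    gcongr
    · exact hg1 v
    · rw [Complex.norm_real, Real.norm_eq_abs, abs_div, abs_of_pos hv, div_le_iff₀ hv]
      calc |(|v| - |u|)| ≤ |v - u| := abs_abs_sub_abs_le v u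
        _ = |u - v| * 1 := by rw [abs_sub_comm, mul_one]
        _ ≤ _ := by gcongr; linarith [abs_nonneg v]
  linarith [hg2 u v]

lemma integrable_one_div_one_add_abs_sq : Integrable fun u : ℝ => (1 / (1 + |u|)) ^ 2 := by
  have := integrable_one_add_norm (E := ℝ) (μ := volume) (r := 2) (by simp)
  refine this.congr (Eventually.of_forall fun u => ?_)
  simp only [Real.norm_eq_abs]
  rw [Real.rpow_neg (by positivity), Real.rpow_two, one_div, inv_pow]

/-- Smooth functions of `log n` are insensitive to the shift by `s`, on average with respect to
the weights `Λ(n) / (n ^ (1 + σ) log n)`. -/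
theorem exists_eventually_norm_sum_mangoldtWeight_shift_le {s : ℝ} (hs : 0 ≤ s) {ε : ℝ}
    (hε : 0 < ε) :
    ∃ K : ℝ, ∀ σ : ℝ, 0 < σ → σ ≤ 1 → ∀ᶠ X : ℕ in atTop, ∀ g : ℝ → ℂ, (∀ u, ‖g u‖ ≤ 1) →
      (∀ u v, ‖g u - g v‖ ≤ 2 * |u - v|) →
      ‖∑ n ∈ range X, ((mangoldtWeight σ n / (1 + Real.log n) : ℝ) : ℂ) *
        (g (Real.log n) - g (Real.log n + s))‖ ≤
        K + ε * ∑ n ∈ range X, mangoldtWeight σ n / (1 + Real.log n) := by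
  obtain ⟨A, hA0, hA⟩ := exists_norm_sum_le_of_exponential_sum_bounded
  -- Makes `6 * A / R ≤ ε / 2`.
  set R : ℝ := 12 * A / ε + 1 with hR
  have hR0 : 0 < R := by positivity
  obtain ⟨M, hM0, hM⟩ := exists_eventually_norm_sum_mangoldtWeight_exp_le R s
  set B : ℝ := ∫ u : ℝ, (1 / (1 + |u|)) ^ 2 with hB
  -- Beyond `T`, `log n ≥ 2 * s / ε`, so changing the denominator `1 + log n` to `1 + log n + s`
  -- costs a relative error of at most `ε / 2`. Smaller `n` go into the constant, all of whose terms
  -- are independent of `σ`.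
  set T : ℕ := ⌈Real.exp (2 * s / ε)⌉₊ with hT
  refine ⟨A * √R * M * √B + ∑ n ∈ range T, s * (vonMangoldt n / n), fun σ h0 h1 => ?_⟩
  filter_upwards [hM σ h0 h1] with X hX g hg1 hg2
  set b := mangoldtWeight σ with hb
  have hb0 : ∀ n, 0 ≤ b n := mangoldtWeight_nonneg σ
  have hlog (n : ℕ) : 0 ≤ Real.log n := Real.log_natCast_nonneg n
  set h : ℝ → ℂ := fun u => g u / (1 + |u| : ℝ) with hh
  have hLip : ∀ u v, ‖h u - h v‖ ≤ 3 / (1 + |u|) * |u - v| := norm_div_one_add_abs_sub_le hg1 hg2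
  have hgc : Continuous g := by
    have : LipschitzWith 2 g := LipschitzWith.of_dist_le_mul fun u v => by
      simpa [dist_eq_norm] using hg2 u v
    exact this.continuous
  have hhc : Continuous h := by
    refine hgc.div (by fun_prop) fun u => ?_
    have : 0 < 1 + |u| := by positivity
    exact_mod_cast this.ne'
  have hhle (u : ℝ) : ‖h u‖ ^ 2 ≤ (1 / (1 + |u|)) ^ 2 := by
    simp only [hh]
    rw [norm_div, Complex.norm_real, Real.norm_of_nonneg (by positivity)]
    gcongr
    exact hg1 u
  have hhint : Integrable fun u => ‖h u‖ ^ 2 := by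
    refine integrable_one_div_one_add_abs_sq.mono' (by fun_prop) (Eventually.of_forall fun u => ?_)
    simpa using hhle u
  have hh2 : MemLp h 2 := (memLp_two_iff_integrable_sq_norm hhc.aestronglyMeasurable).2 hhint
  have hhB : ∫ u, ‖h u‖ ^ 2 ≤ B := integral_mono hhint integrable_one_div_one_add_abs_sq hhle
  set S := ∑ n ∈ range X, b n / (1 + Real.log n) with hS
  have hS0 : 0 ≤ S := Finset.sum_nonneg fun n _ => div_nonneg (hb0 n) (by linarith [hlog n])
  have key : ‖∑ n ∈ range X, (b n : ℂ) * (h (Real.log n) - h (Real.log n + s))‖ ≤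
      A * √R * M * √B + ε / 2 * S := by
    -- The points `log n` carry weight `b n` and their shifts `log n + s` carry weight `-b n`.
    have := hA R hR0 ((range X).disjSum (range X)) (Sum.elim (fun n => (b n : ℂ)) fun n => -b n)
      (Sum.elim (fun n => Real.log n) fun n => Real.log n + s) M hM0 (fun t ht => by
        rw [Finset.sum_disjSum]
        simp only [Sum.elim_inl, Sum.elim_inr]
        rw [← Finset.sum_add_distrib]
        refine (congrArg norm (Finset.sum_congr rfl fun n _ => ?_)).trans_le (hX t ht)
        ring) h hh2 hhc _ hLip
    rw [Finset.sum_disjSum, Finset.sum_disjSum] at this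
    simp only [Sum.elim_inl, Sum.elim_inr] at this
    rw [← Finset.sum_add_distrib, ← Finset.sum_add_distrib] at this
    have e : ∑ n ∈ range X, (b n : ℂ) * (h (Real.log n) - h (Real.log n + s)) =
      ∑ n ∈ range X, ((b n : ℂ) * h (Real.log n) + -(b n : ℂ) * h (Real.log n + s)) :=
      Finset.sum_congr rfl fun n _ => by ring
    rw [e]
    refine this.trans (add_le_add (by gcongr) ?_)
    calc _ ≤ A / R * ∑ n ∈ range X, 6 * (b n / (1 + Real.log n)) := by
          gcongr with n _
          rw [norm_neg, Complex.norm_real, Real.norm_of_nonneg (hb0 n), abs_of_nonneg (hlog n),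
            abs_of_nonneg (add_nonneg (hlog n) hs)]
          have h1 : 3 / (1 + (Real.log n + s)) ≤ 3 / (1 + Real.log n) := by
            have := hlog n
            gcongr
            linarith
          have := mul_le_mul_of_nonneg_left h1 (hb0 n)
          calc _ ≤ b n * (3 / (1 + Real.log n)) + b n * (3 / (1 + Real.log n)) := by linarith
            _ = _ := by ring
      _ = 6 * A / R * S := by rw [← Finset.mul_sum]; ring
      _ ≤ ε / 2 * S := by
          refine mul_le_mul_of_nonneg_right ?_ hS0
          rw [div_le_iff₀ hR0, hR]
          have : ε / 2 * (12 * A / ε + 1) = 6 * A + ε / 2 := by field_simp; ring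
          linarith
  have herr (n : ℕ) : ‖(b n : ℂ) * (g (Real.log n + s) *
      ((1 / (1 + Real.log n + s) - 1 / (1 + Real.log n) : ℝ) : ℂ))‖ ≤
      ε / 2 * (b n / (1 + Real.log n)) + if n < T then s * (vonMangoldt n / n) else 0 := by
    have hn := hlog n
    have e : |1 / (1 + Real.log n + s) - 1 / (1 + Real.log n)| =
        s / ((1 + Real.log n) * (1 + Real.log n + s)) := by
      rw [div_sub_div _ _ (by positivity) (by positivity), abs_div, abs_of_nonneg
        (by positivity : 0 ≤ (1 + Real.log n + s) * (1 + Real.log n))]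
      rw [show 1 * (1 + Real.log n) - (1 + Real.log n + s) * 1 = -s by ring, abs_neg,
        abs_of_nonneg hs, mul_comm (1 + Real.log n)]
    rw [norm_mul, norm_mul, Complex.norm_real, Complex.norm_real, Real.norm_of_nonneg (hb0 n),
      Real.norm_eq_abs, e]
    have hfirst : b n * (‖g (Real.log n + s)‖ * (s / ((1 + Real.log n) * (1 + Real.log n + s)))) ≤
        b n * (1 * (s / ((1 + Real.log n) * (1 + Real.log n + s)))) := by
      have := hb0 n
      gcongr
      exact hg1 _
    refine hfirst.trans ?_
    split_ifs with hnT
    · have h1 : s / ((1 + Real.log n) * (1 + Real.log n + s)) ≤ s := by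
        refine div_le_self hs ?_
        nlinarith
      have h2 : b n * (1 * (s / ((1 + Real.log n) * (1 + Real.log n + s)))) ≤
          (vonMangoldt n / n) * s := by
        rw [one_mul]
        exact mul_le_mul (mangoldtWeight_le h0.le n) h1 (by positivity)
          (div_nonneg vonMangoldt_nonneg (by positivity))
      have h3 : 0 ≤ ε / 2 * (b n / (1 + Real.log n)) := by
        have := hb0 n
        positivity
      linarith
    · have hln : 2 * s / ε ≤ Real.log n := by
        rw [Real.le_log_iff_exp_le]
        · exact (Nat.le_ceil _).trans (by exact_mod_cast not_lt.1 hnT)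
        · have : 0 < T := Nat.ceil_pos.2 (Real.exp_pos _)
          exact_mod_cast this.trans_le (not_lt.1 hnT)
      rw [add_zero]
      calc b n * (1 * (s / ((1 + Real.log n) * (1 + Real.log n + s))))
          = b n / (1 + Real.log n) * (s / (1 + Real.log n + s)) := by
            field_simp
        _ ≤ b n / (1 + Real.log n) * (ε / 2) := by
            have := hb0 n
            refine mul_le_mul_of_nonneg_left ?_ (by positivity)
            rw [div_le_iff₀ (by positivity)]
            rw [div_le_iff₀ hε] at hln
            nlinarith
        _ = _ := by ring
  have hsplit : ∑ n ∈ range X, ((b n / (1 + Real.log n) : ℝ) : ℂ) *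
        (g (Real.log n) - g (Real.log n + s)) =
      ∑ n ∈ range X, (b n : ℂ) * (h (Real.log n) - h (Real.log n + s))
      + ∑ n ∈ range X, (b n : ℂ) * (g (Real.log n + s) *
      ((1 / (1 + Real.log n + s) - 1 / (1 + Real.log n) : ℝ) : ℂ)) := by
    rw [← Finset.sum_add_distrib]
    refine Finset.sum_congr rfl fun n _ => ?_
    simp only [hh]
    rw [abs_of_nonneg (hlog n), abs_of_nonneg (add_nonneg (hlog n) hs), ← add_assoc]
    push_cast
    ring
  rw [hsplit]
  refine (norm_add_le _ _).trans ((add_le_add key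
    ((norm_sum_le _ _).trans (Finset.sum_le_sum fun n _ => herr n))).trans ?_)
  rw [Finset.sum_add_distrib, ← Finset.mul_sum, ← hS, ← Finset.sum_filter]
  have : ∑ n ∈ range X with n < T, s * (vonMangoldt n / n) ≤
      ∑ n ∈ range T, s * (vonMangoldt n / n) := by
    refine Finset.sum_le_sum_of_subset_of_nonneg (fun n hn => ?_) fun n _ _ => ?_
    · exact Finset.mem_range.2 (Finset.mem_filter.1 hn).2
    · exact mul_nonneg hs (div_nonneg vonMangoldt_nonneg (by positivity))
  linarith

end

/-! ### Prime weights, slow variation and the main theorem -/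

section

open Finset Filter Topology MeasureTheory ArithmeticFunction ArithmeticFunction.vonMangoldt

/-- The weight `p ^ (-σ) log p / (1 + log p)`. -/
noncomputable def primeWeight (σ : ℝ) (p : ℕ) : ℝ :=
  Real.log p / (1 + Real.log p) * (p : ℝ) ^ (-σ)

lemma primeWeight_nonneg (σ : ℝ) (p : ℕ) : 0 ≤ primeWeight σ p := by
  have := Real.log_natCast_nonneg p
  rw [primeWeight]
  positivity

lemma primeWeight_le_one {σ : ℝ} (hσ : 0 ≤ σ) {p : ℕ} (hp : p.Prime) : primeWeight σ p ≤ 1 := by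
  have h := Real.log_natCast_nonneg p
  refine mul_le_one₀ ?_ (by positivity) ?_
  · rw [div_le_one (by positivity)]
    linarith
  · exact Real.rpow_le_one_of_one_le_of_nonpos (by exact_mod_cast hp.one_le) (by linarith)

lemma mangoldtWeight_div_eq_primeWeight_div (σ : ℝ) {p : ℕ} (hp : p.Prime) :
    mangoldtWeight σ p / (1 + Real.log p) = primeWeight σ p / p := by
  have hp0 : (0 : ℝ) < p := by exact_mod_cast hp.pos
  rw [mangoldtWeight, primeWeight, vonMangoldt_apply_prime hp, neg_add, Real.rpow_add hp0,
    Real.rpow_neg_one]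
  ring

/-- Non-prime `n` contribute at most the convergent sum `K'` of `Λ(n) / n` over proper prime powers,
so discarding them only enlarges the constant. -/
theorem exists_eventually_norm_sum_primeWeight_shift_le {s : ℝ} (hs : 0 ≤ s) {ε : ℝ}
    (hε : 0 < ε) :
    ∃ K : ℝ, ∀ σ : ℝ, 0 < σ → σ ≤ 1 → ∀ᶠ X : ℕ in atTop, ∀ g : ℝ → ℂ, (∀ u, ‖g u‖ ≤ 1) →
      (∀ u v, ‖g u - g v‖ ≤ 2 * |u - v|) →
      ‖∑ p ∈ range X with p.Prime, ((primeWeight σ p / p : ℝ) : ℂ) *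
        (g (Real.log p) - g (Real.log p + s))‖ ≤
        K + ε * ∑ p ∈ range X with p.Prime, primeWeight σ p / p := by
  obtain ⟨K, hK⟩ := exists_eventually_norm_sum_mangoldtWeight_shift_le hs hε
  have hsum := summable_residueClass_non_primes_div (1 : ZMod 1)
  simp only [residueClass_zmod_one] at hsum
  set K' := ∑' n : ℕ, (if n.Prime then 0 else vonMangoldt n) / n with hK'
  refine ⟨K + (ε + 2) * K', fun σ h0 h1 => ?_⟩
  filter_upwards [hK σ h0 h1] with X hX g hg1 hg2
  have hX := hX g hg1 hg2
  set b : ℕ → ℝ := fun n => mangoldtWeight σ n / (1 + Real.log n) with hb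
  have hb0 (n : ℕ) : 0 ≤ b n :=
    div_nonneg (mangoldtWeight_nonneg σ n) (by linarith [Real.log_natCast_nonneg n])
  have hble (n : ℕ) : b n ≤ vonMangoldt n / n :=
    (div_le_self (mangoldtWeight_nonneg σ n) (by linarith [Real.log_natCast_nonneg n])).trans
      (mangoldtWeight_le h0.le n)
  have hnp : ∑ n ∈ range X with ¬ n.Prime, b n ≤ K' := by
    rw [Finset.sum_filter]
    refine le_trans (Finset.sum_le_sum fun n _ => ?_) (hsum.sum_le_tsum (range X) fun n _ => ?_)
    · by_cases hn : n.Prime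
      · simp [hn]
      · simpa [hn] using hble n
    · split_ifs
      · simp
      · exact div_nonneg vonMangoldt_nonneg (by positivity)
  have e1 : ∑ p ∈ range X with p.Prime, primeWeight σ p / p = ∑ p ∈ range X with p.Prime, b p :=
    Finset.sum_congr rfl fun p hp =>
      (mangoldtWeight_div_eq_primeWeight_div σ (Finset.mem_filter.1 hp).2).symm
  have e2 : ∑ p ∈ range X with p.Prime, ((primeWeight σ p / p : ℝ) : ℂ) *
        (g (Real.log p) - g (Real.log p + s)) = ∑ p ∈ range X with p.Prime, (b p : ℂ) *
        (g (Real.log p) - g (Real.log p + s)) :=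
    Finset.sum_congr rfl fun p hp => by
      simp only [hb, mangoldtWeight_div_eq_primeWeight_div σ (Finset.mem_filter.1 hp).2]
  have hnp2 : ‖∑ n ∈ range X with ¬ n.Prime, (b n : ℂ) * (g (Real.log n) - g (Real.log n + s))‖ ≤
      2 * K' := by
    refine (norm_sum_le _ _).trans (le_trans (Finset.sum_le_sum fun n _ => ?_)
      ((Finset.mul_sum _ _ _).symm.trans_le (mul_le_mul_of_nonneg_left hnp zero_le_two)))
    rw [norm_mul, Complex.norm_real, Real.norm_of_nonneg (hb0 n), mul_comm]
    gcongr
    · exact hb0 n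
    · refine (norm_sub_le _ _).trans ?_
      linarith [hg1 (Real.log n), hg1 (Real.log n + s)]
  rw [e1, e2]
  rw [← Finset.sum_filter_add_sum_filter_not (range X) Nat.Prime (fun n => b n),
    ← Finset.sum_filter_add_sum_filter_not (range X) Nat.Prime
      (fun n => (b n : ℂ) * (g (Real.log n) - g (Real.log n + s)))] at hX
  have h3 := norm_sub_le_norm_add (∑ p ∈ range X with p.Prime, (b p : ℂ) *
        (g (Real.log p) - g (Real.log p + s))) (∑ n ∈ range X with ¬ n.Prime, (b n : ℂ) *
        (g (Real.log n) - g (Real.log n + s)))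
  have h4 := mul_le_mul_of_nonneg_left hnp hε.le
  linarith

/-- The total mass of the prime weights tends to infinity as `σ → 0`. -/
lemma exists_eventually_le_sum_primeWeight (B : ℝ) :
    ∃ σ : ℝ, 0 < σ ∧ σ ≤ 1 ∧ ∀ᶠ X : ℕ in atTop,
      B ≤ ∑ p ∈ range X with p.Prime, primeWeight σ p / p := by
  have hdiv := not_summable_one_div_on_primes
  rw [not_summable_iff_tendsto_nat_atTop_of_nonneg
    (fun n => Set.indicator_nonneg (fun _ _ => by positivity) n)] at hdiv
  -- At `σ = 0` each weight is at least 1/3, since `log 2 ≥ 1/2`; this explains the factor 3. The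
  -- extra 1 leaves room for moving a fixed finite sum to a small positive `σ` by continuity.
  obtain ⟨X₀, hX₀⟩ := (hdiv.eventually_ge_atTop (3 * (B + 1))).exists
  have hX0 : B + 1 ≤ ∑ p ∈ range X₀ with p.Prime, primeWeight 0 p / p := by
    have : ∑ n ∈ range X₀, Set.indicator {p : ℕ | p.Prime} (fun n : ℕ => (1 : ℝ) / n) n =
        ∑ p ∈ range X₀ with p.Prime, (1 : ℝ) / p := by
      rw [Finset.sum_filter]
      simp only [Set.indicator_apply, Set.mem_ofPred_eq]
    rw [this] at hX₀
    have h2 : ∑ p ∈ range X₀ with p.Prime, (1 : ℝ) / p ≤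
        ∑ p ∈ range X₀ with p.Prime, 3 * (primeWeight 0 p / p) := by
      refine Finset.sum_le_sum fun p hp => ?_
      have hp' := (Finset.mem_filter.1 hp).2
      have hl : Real.log 2 ≤ Real.log p :=
        Real.log_le_log two_pos (by exact_mod_cast hp'.two_le)
      have := Real.log_two_gt_d9
      have hl0 : 0 < 1 + Real.log p := by linarith
      rw [primeWeight, neg_zero, Real.rpow_zero, mul_one, ← mul_div_assoc]
      gcongr
      rw [← mul_div_assoc, le_div_iff₀ hl0]
      linarith
    rw [← Finset.mul_sum] at h2
    linarith
  have hcont : ContinuousAt (fun σ : ℝ => ∑ p ∈ range X₀ with p.Prime, primeWeight σ p / p) 0 := by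
    refine tendsto_finsetSum _ fun p hp => ?_
    have hp0 : (p : ℝ) ≠ 0 := by exact_mod_cast (Finset.mem_filter.1 hp).2.ne_zero
    refine Tendsto.div_const (Tendsto.const_mul _ ?_) _
    exact ((Real.continuousAt_const_rpow hp0).comp continuousAt_neg)
  have hev : ∀ᶠ σ : ℝ in 𝓝[>] 0, B ≤ ∑ p ∈ range X₀ with p.Prime, primeWeight σ p / p :=
    (hcont.tendsto.mono_left nhdsWithin_le_nhds).eventually_const_le (by linarith)
  obtain ⟨σ, hσ, hσ0, hσ1⟩ := (hev.and (Ioc_mem_nhdsGT (zero_lt_one (α := ℝ)))).exists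
  refine ⟨σ, hσ0, hσ1, ?_⟩
  filter_upwards [eventually_ge_atTop X₀] with X hX
  refine hσ.trans (Finset.sum_le_sum_of_subset_of_nonneg ?_ fun p _ _ => ?_)
  · exact Finset.filter_subset_filter _ (Finset.range_subset_range.2 hX)
  · exact div_nonneg (primeWeight_nonneg σ p) (by positivity)

lemma cardFactors_prime_mul {p m : ℕ} (hp : p.Prime) (hm : 1 ≤ m) :
    cardFactors (p * m) = cardFactors m + 1 := by
  rw [cardFactors_mul hp.ne_zero (by omega), cardFactors_apply_prime hp, add_comm]

/-- Means of functions of `Ω(n)` vary slowly. -/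
theorem tendsto_contMean_cardFactors_sub_div {f : ℕ → ℂ} (hf : ∀ k, ‖f k‖ ≤ 1) {q : ℕ}
    (hq : 1 ≤ q) :
    Tendsto (fun y : ℝ => contMean (fun n => f (cardFactors n)) y
      - contMean (fun n => f (cardFactors n)) (y / q)) atTop (𝓝 0) := by
  set a : ℕ → ℂ := fun n => f (cardFactors n) with ha
  set b : ℕ → ℂ := fun n => f (cardFactors n + 1) with hb
  have ha1 : ∀ n, ‖a n‖ ≤ 1 := fun n => hf _
  have hb1 : ∀ n, ‖b n‖ ≤ 1 := fun n => hf _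
  have hq0 : (0 : ℝ) < q := by exact_mod_cast hq
  rw [NormedAddGroup.tendsto_nhds_zero]
  intro ε hε
  obtain ⟨K, hK⟩ := exists_eventually_norm_sum_primeWeight_shift_le
    (Real.log_natCast_nonneg q) (by positivity : 0 < ε / 4)
  -- `K` is uniform in `σ`, so the mass S can be chosen after it: large enough that `K` and `4 * √S`
  -- are each at most `ε / 4 * S`.
  obtain ⟨σ, hσ0, hσ1, hS⟩ :=
    exists_eventually_le_sum_primeWeight (1 + (16 / ε) ^ 2 + 4 * |K| / ε)
  obtain ⟨X, hX1, hX2⟩ := ((hK σ hσ0 hσ1).and hS).exists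
  set P := {p ∈ range X | p.Prime} with hP
  have hPp : ∀ p ∈ P, p.Prime := fun p hp => (Finset.mem_filter.1 hp).2
  set S := ∑ p ∈ P, primeWeight σ p / p with hSdef
  have hTK := eventually_norm_contMean_sub_prime_average_le P hPp (primeWeight σ)
    (fun p _ => primeWeight_nonneg σ p) (fun p hp => primeWeight_le_one hσ0.le (hPp p hp)) ha1 hb1
    (fun p hp m hm => by simp only [ha, hb, cardFactors_prime_mul (hPp p hp) hm])
  have hTKq := (tendsto_id.atTop_div_const hq0).eventually hTK
  filter_upwards [hTK, hTKq, eventually_gt_atTop 0] with y h1 h2 hy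
  simp only [id] at h2
  -- Uniformity in `g` is essential: `g` varies with `y`, while `σ` and `X` are already fixed.
  have h3 := hX1 (fun u => contMean b (y * Real.exp (-u))) (fun u => norm_contMean_le hb1 _)
    (fun u v => by
      refine (norm_contMean_sub_le hb1 (by positivity) (by positivity)).trans_eq ?_
      rw [Real.log_mul hy.ne' (Real.exp_ne_zero _), Real.log_mul hy.ne' (Real.exp_ne_zero _),
        Real.log_exp, Real.log_exp, abs_sub_comm]
      congr 2
      ring)
  have e : ∑ p ∈ P, ((primeWeight σ p / p : ℝ) : ℂ) *
      (contMean b (y * Real.exp (-Real.log p)) - contMean b (y * Real.exp (-(Real.log p + Real.log q))))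
      = ∑ p ∈ P, ((primeWeight σ p / p : ℝ) : ℂ) * contMean b (y / p)
        - ∑ p ∈ P, ((primeWeight σ p / p : ℝ) : ℂ) * contMean b (y / q / p) := by
    rw [← Finset.sum_sub_distrib]
    refine Finset.sum_congr rfl fun p hp => ?_
    have hp0 : (0 : ℝ) < p := by exact_mod_cast (hPp p hp).pos
    rw [neg_add, Real.exp_add, Real.exp_neg, Real.exp_neg, Real.exp_log hp0, Real.exp_log hq0,
      mul_sub]
    congr 3
    field_simp
  rw [e] at h3
  have hS1 : 1 ≤ S := by
    have : 0 ≤ (16 / ε) ^ 2 + 4 * |K| / ε := by positivity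
    linarith
  have hSpos : 0 < S := by linarith
  have hKS : K ≤ ε / 4 * S := by
    have h5 : 4 * |K| / ε ≤ S := by
      have : 0 ≤ (16 / ε) ^ 2 := by positivity
      linarith
    rw [div_le_iff₀ hε] at h5
    linarith [le_abs_self K]
  have hsq : 4 * √S ≤ ε / 4 * S := by
    have h5 : 16 / ε ≤ √S := Real.le_sqrt_of_sq_le (by
      have : 0 ≤ 4 * |K| / ε := by positivity
      linarith)
    rw [div_le_iff₀ hε] at h5
    have h6 := Real.mul_self_sqrt hSpos.le
    nlinarith [Real.sqrt_nonneg S]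
  have hsq1 : 1 ≤ √S := Real.one_le_sqrt.2 hS1
  have htot : S * ‖contMean a y - contMean a (y / q)‖ ≤ 3 * ε / 4 * S := by
    calc S * ‖contMean a y - contMean a (y / q)‖
        = ‖(S : ℂ) * (contMean a y - contMean a (y / q))‖ := by
          rw [norm_mul, Complex.norm_real, Real.norm_of_nonneg hSpos.le]
      _ = ‖((S : ℂ) * contMean a y - ∑ p ∈ P, ((primeWeight σ p / p : ℝ) : ℂ) * contMean b (y / p))
          - ((S : ℂ) * contMean a (y / q)
              - ∑ p ∈ P, ((primeWeight σ p / p : ℝ) : ℂ) * contMean b (y / q / p))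
          + (∑ p ∈ P, ((primeWeight σ p / p : ℝ) : ℂ) * contMean b (y / p)
        - ∑ p ∈ P, ((primeWeight σ p / p : ℝ) : ℂ) * contMean b (y / q / p))‖ := by
          congr 1
          ring
      _ ≤ (√S + 1) + (√S + 1) + (K + ε / 4 * S) :=
          (norm_add_le _ _).trans (add_le_add ((norm_sub_le _ _).trans (add_le_add h1 h2)) h3)
      _ ≤ _ := by linarith
  have := le_of_mul_le_mul_left (htot.trans_eq (mul_comm _ _)) hSpos
  linarith

/-- Slow variation of the means of `b` replaces each `y / p` by `y` in the finite Turán–Kubilius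
average, which becomes S times the mean of `b`. -/
theorem tendsto_contMean_cardFactors_sub_add_one {f : ℕ → ℂ} (hf : ∀ k, ‖f k‖ ≤ 1) :
    Tendsto (fun y : ℝ => contMean (fun n => f (cardFactors n + 1)) y
      - contMean (fun n => f (cardFactors n)) y) atTop (𝓝 0) := by
  set a : ℕ → ℂ := fun n => f (cardFactors n) with ha
  set b : ℕ → ℂ := fun n => f (cardFactors n + 1) with hb
  have ha1 : ∀ n, ‖a n‖ ≤ 1 := fun n => hf _
  have hb1 : ∀ n, ‖b n‖ ≤ 1 := fun n => hf _
  rw [NormedAddGroup.tendsto_nhds_zero]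
  intro ε hε
  obtain ⟨σ, hσ0, hσ1, hS⟩ := exists_eventually_le_sum_primeWeight (1 + (6 / ε) ^ 2)
  obtain ⟨X, hX⟩ := hS.exists
  set P := {p ∈ range X | p.Prime} with hP
  have hPp : ∀ p ∈ P, p.Prime := fun p hp => (Finset.mem_filter.1 hp).2
  set S := ∑ p ∈ P, primeWeight σ p / p with hSdef
  have hTK := eventually_norm_contMean_sub_prime_average_le P hPp (primeWeight σ)
    (fun p _ => primeWeight_nonneg σ p) (fun p hp => primeWeight_le_one hσ0.le (hPp p hp)) ha1 hb1
    (fun p hp m hm => by simp only [ha, hb, cardFactors_prime_mul (hPp p hp) hm])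
  have hlim : Tendsto (fun y : ℝ => ∑ p ∈ P, ((primeWeight σ p / p : ℝ) : ℂ) *
      (contMean b y - contMean b (y / p))) atTop (𝓝 0) := by
    rw [show (0 : ℂ) = ∑ p ∈ P, ((primeWeight σ p / p : ℝ) : ℂ) * 0 by simp]
    exact tendsto_finsetSum _ fun p hp => Tendsto.const_mul _
      (tendsto_contMean_cardFactors_sub_div (f := fun k => f (k + 1)) (fun k => hf _)
        (hPp p hp).one_le)
  rw [NormedAddGroup.tendsto_nhds_zero] at hlim
  filter_upwards [hTK, hlim 1 one_pos] with y h1 h2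
  have hS1 : 1 ≤ S := by
    have : 0 ≤ (6 / ε) ^ 2 := by positivity
    linarith
  have hSpos : 0 < S := by linarith
  have hsq : 6 * √S ≤ ε * S := by
    have h5 : 6 / ε ≤ √S := Real.le_sqrt_of_sq_le (by linarith)
    rw [div_le_iff₀ hε] at h5
    have h6 := Real.mul_self_sqrt hSpos.le
    nlinarith [Real.sqrt_nonneg S]
  have hsq1 : 1 ≤ √S := Real.one_le_sqrt.2 hS1
  have htot : S * ‖contMean b y - contMean a y‖ ≤ ε / 2 * S := by
    calc S * ‖contMean b y - contMean a y‖
        = ‖(S : ℂ) * (contMean b y - contMean a y)‖ := by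
          rw [norm_mul, Complex.norm_real, Real.norm_of_nonneg hSpos.le]
      _ = ‖(∑ p ∈ P, ((primeWeight σ p / p : ℝ) : ℂ) * (contMean b y - contMean b (y / p)))
          - ((S : ℂ) * contMean a y
            - ∑ p ∈ P, ((primeWeight σ p / p : ℝ) : ℂ) * contMean b (y / p))‖ := by
          congr 1
          simp_rw [mul_sub, Finset.sum_sub_distrib, ← Finset.sum_mul]
          rw [hSdef, Complex.ofReal_sum]
          ring
      _ ≤ 1 + (√S + 1) := (norm_sub_le _ _).trans (add_le_add h2.le h1)
      _ ≤ _ := by linarith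
  have := le_of_mul_le_mul_left (htot.trans_eq (mul_comm _ _)) hSpos
  linarith

/-- The distributions of `Ω(n) + 1` and of `Ω(n)` agree asymptotically on every bounded
function. -/
theorem tendsto_mean_cardFactors_add_one_sub {f : ℕ → ℂ} (hf : ∃ C : ℝ, ∀ k, ‖f k‖ ≤ C) :
    Tendsto (fun N : ℕ => (1 / (N : ℂ)) * ∑ n ∈ Icc 1 N, f (cardFactors n + 1)
      - (1 / (N : ℂ)) * ∑ n ∈ Icc 1 N, f (cardFactors n)) atTop (𝓝 0) := by
  obtain ⟨C, hC⟩ := hf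
  have hC0 : 0 ≤ C := (norm_nonneg _).trans (hC 0)
  -- Normalizing by `C + 1` avoids division by zero when `C = 0`.
  have hD : ((C + 1 : ℝ) : ℂ) ≠ 0 := by exact_mod_cast (by positivity : C + 1 ≠ 0)
  have hf' : ∀ k, ‖f k / (C + 1 : ℝ)‖ ≤ 1 := by
    intro k
    rw [norm_div, Complex.norm_real, Real.norm_of_nonneg (by positivity),
      div_le_one (by positivity)]
    linarith [hC k]
  have h := ((tendsto_contMean_cardFactors_sub_add_one hf').comp
    tendsto_natCast_atTop_atTop).const_mul ((C + 1 : ℝ) : ℂ)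
  rw [mul_zero] at h
  refine h.congr fun N => ?_
  simp only [Function.comp_apply, contMean]
  rw [integral_comp_ceil_natCast (a := fun n => f (cardFactors n + 1) / (C + 1 : ℝ)) (fun n => hf' _),
    integral_comp_ceil_natCast (a := fun n => f (cardFactors n) / (C + 1 : ℝ)) (fun n => hf' _),
    ← Finset.sum_div, ← Finset.sum_div, Complex.ofReal_natCast]
  field_simp

end

/-! ### Weyl's criterion -/

section

open Finset Filter Topology MeasureTheory ArithmeticFunction

lemma norm_mean_le {F : ℕ → ℂ} {C : ℝ} (hC : 0 ≤ C) (hF : ∀ n, ‖F n‖ ≤ C) (N : ℕ) :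
    ‖(1 / (N : ℂ)) * ∑ n ∈ Icc 1 N, F n‖ ≤ C := by
  have h : ‖∑ n ∈ Icc 1 N, F n‖ ≤ N * C := by
    refine (norm_sum_le_of_le _ fun n _ => hF n).trans ?_
    simp
  rw [norm_mul, norm_div, norm_one, Complex.norm_natCast]
  rcases Nat.eq_zero_or_pos N with rfl | hN
  · simpa using hC
  · have : (0 : ℝ) < N := by exact_mod_cast hN
    rw [one_div_mul_eq_div, div_le_iff₀ this, mul_comm]
    exact h

/-- Weyl's criterion for continuous functions on the circle. -/
theorem tendsto_mean_of_tendsto_mean_fourier {x : ℕ → UnitAddCircle}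
    (hx : ∀ k : ℤ, k ≠ 0 → Tendsto (fun N : ℕ => (1 / (N : ℂ)) *
      ∑ n ∈ Icc 1 N, fourier k (x n)) atTop (𝓝 0)) (F : C(UnitAddCircle, ℂ)) :
    Tendsto (fun N : ℕ => (1 / (N : ℂ)) * ∑ n ∈ Icc 1 N, F (x n)) atTop
      (𝓝 (∫ z, F z ∂AddCircle.haarAddCircle)) := by
  set μ : Measure UnitAddCircle := AddCircle.haarAddCircle with hμ
  have hint (G : C(UnitAddCircle, ℂ)) : Integrable G μ :=
    G.continuous.integrable_of_hasCompactSupport (HasCompactSupport.of_compactSpace _)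
  have hspan : ∀ G ∈ Submodule.span ℂ (Set.range (fourier (T := 1))),
      Tendsto (fun N : ℕ => (1 / (N : ℂ)) * ∑ n ∈ Icc 1 N, G (x n)) atTop (𝓝 (∫ z, G z ∂μ)) := by
    intro G hG
    induction hG using Submodule.span_induction with
    | mem G hG =>
      obtain ⟨k, rfl⟩ := hG
      by_cases hk : k = 0
      · subst hk
        simp only [fourier_zero, integral_const, probReal_univ, one_smul]
        refine tendsto_const_nhds.congr' ?_
        filter_upwards [eventually_ge_atTop 1] with N hN
        have : (N : ℂ) ≠ 0 := by exact_mod_cast (by omega : N ≠ 0)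
        simp [this]
      · rw [integral_eq_zero_of_add_right_eq_neg (μ := μ)
          (fourier_add_half_inv_index hk zero_lt_one)]
        exact hx k hk
    | zero => simp
    | add G H _ _ hG hH =>
      simp only [ContinuousMap.add_apply, Finset.sum_add_distrib, mul_add]
      rw [integral_add (hint G) (hint H)]
      exact hG.add hH
    | smul c G _ hG =>
      simp only [ContinuousMap.smul_apply, smul_eq_mul, ← Finset.mul_sum]
      rw [integral_const_mul]
      refine (hG.const_mul c).congr fun N => ?_
      ring
  have hF : F ∈ (Submodule.span ℂ (Set.range (fourier (T := 1)))).topologicalClosure := by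
    rw [span_fourier_closure_eq_top]
    trivial
  rw [Metric.tendsto_nhds]
  intro ε hε
  obtain ⟨G, hG, hFG⟩ := Metric.mem_closure_iff.1 hF (ε / 3) (by positivity)
  have hpt (z : UnitAddCircle) : ‖F z - G z‖ ≤ ε / 3 := by
    rw [← dist_eq_norm]
    exact (ContinuousMap.dist_apply_le_dist z).trans hFG.le
  filter_upwards [Metric.tendsto_nhds.1 (hspan G hG) (ε / 3) (by positivity)] with N hN
  have h1 : ‖(1 / (N : ℂ)) * ∑ n ∈ Icc 1 N, F (x n) - (1 / (N : ℂ)) * ∑ n ∈ Icc 1 N, G (x n)‖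
      ≤ ε / 3 := by
    rw [← mul_sub, ← Finset.sum_sub_distrib]
    exact norm_mean_le (by positivity) (fun n => hpt (x n)) N
  have h2 : ‖∫ z, F z ∂μ - ∫ z, G z ∂μ‖ ≤ ε / 3 := by
    rw [← integral_sub (hint F) (hint G)]
    simpa using norm_integral_le_of_norm_le_const (μ := μ) (Eventually.of_forall hpt)
  rw [dist_eq_norm] at hN ⊢
  calc _ = ‖((1 / (N : ℂ)) * ∑ n ∈ Icc 1 N, F (x n) - (1 / (N : ℂ)) * ∑ n ∈ Icc 1 N, G (x n))
        + ((1 / (N : ℂ)) * ∑ n ∈ Icc 1 N, G (x n) - ∫ z, G z ∂μ)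
        - (∫ z, F z ∂μ - ∫ z, G z ∂μ)‖ := by congr 1; ring
    _ ≤ _ := (norm_sub_le _ _).trans (add_le_add (norm_add_le _ _) le_rfl)
    _ < ε := by linarith

/-- The proportion of `1 ≤ n ≤ N` with `n ∈ A`. -/
noncomputable def proportion (A : Set ℕ) (N : ℕ) : ℝ :=
  open scoped Classical in (#{n ∈ Icc 1 N | n ∈ A} : ℝ) / N

lemma hasNaturalDensity_iff_tendsto_proportion {A : Set ℕ} {d : ℝ} :
    HasNaturalDensity A d ↔ Tendsto (proportion A) atTop (𝓝 d) := Iff.rfl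

open scoped Classical in
lemma proportion_eq_sum (A : Set ℕ) (N : ℕ) :
    proportion A N = (∑ n ∈ Icc 1 N, if n ∈ A then (1 : ℝ) else 0) / N := by
  rw [proportion, Finset.sum_boole]

open scoped Classical in
lemma ofReal_proportion (A : Set ℕ) (N : ℕ) :
    (proportion A N : ℂ) = 1 / (N : ℂ) * ∑ n ∈ Icc 1 N, if n ∈ A then (1 : ℂ) else 0 := by
  rw [proportion_eq_sum, one_div_mul_eq_div]
  push_cast
  congr 1
  exact Finset.sum_congr rfl fun n _ => by split_ifs <;> simp

/-- Weyl's criterion, upper bound for arcs. -/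
lemma eventually_proportion_fract_lt_of_tendsto_mean_fourier {x : ℕ → ℝ}
    (hx : ∀ k : ℤ, k ≠ 0 → Tendsto (fun N : ℕ => (1 / (N : ℂ)) *
      ∑ n ∈ Icc 1 N, fourier k (x n : UnitAddCircle)) atTop (𝓝 0)) {a b : ℝ} (ha : 0 ≤ a)
    (hab : a ≤ b) (hb : b ≤ 1) {ε : ℝ} (hε : 0 < ε) :
    ∀ᶠ N in atTop, proportion {n | Int.fract (x n) ∈ Set.Ico a b} N < b - a + ε := by
  classical
  set μ : Measure UnitAddCircle := AddCircle.haarAddCircle with hμ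
  have hvol : (volume : Measure UnitAddCircle) = μ := by
    rw [AddCircle.volume_eq_smul_haarAddCircle]
    simp [hμ]
  set K : Set UnitAddCircle := Metric.closedBall (((a + b) / 2 : ℝ) : UnitAddCircle) ((b - a) / 2)
    with hK
  have hμK : μ K = ENNReal.ofReal (b - a) := by
    rw [← hvol, hK, AddCircle.volume_closedBall]
    congr 1
    rw [min_eq_right (by linarith)]
    ring
  -- Outer regularity and Urysohn's lemma give a continuous majorant of the closed arc whose
  -- integral exceeds its length by at most `ε / 2`.
  obtain ⟨U, hKU, hUo, hU⟩ := K.exists_isOpen_lt_of_lt (μ := μ) (ENNReal.ofReal (b - a + ε / 2))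
    (by rw [hμK]; exact (ENNReal.ofReal_lt_ofReal_iff (by linarith)).2 (by linarith))
  obtain ⟨F, hF0, hF1, hF⟩ := exists_continuous_zero_one_of_isClosed hUo.isClosed_compl
    Metric.isClosed_closedBall (Set.disjoint_compl_left_iff_subset.2 hKU)
  have hFint : Integrable F μ :=
    F.continuous.integrable_of_hasCompactSupport (HasCompactSupport.of_compactSpace _)
  have hFle : ∫ z, F z ∂μ ≤ b - a + ε / 2 := by
    calc ∫ z, F z ∂μ ≤ ∫ z, U.indicator 1 z ∂μ := by
          refine integral_mono hFint ((integrable_indicator_iff hUo.measurableSet).2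
            (integrable_const (1 : ℝ)).integrableOn) fun z => ?_
          by_cases hz : z ∈ U
          · simpa [hz] using (hF z).2
          · simpa [hz] using (hF0 hz).le
      _ = μ.real U := integral_indicator_one hUo.measurableSet
      _ ≤ _ := ENNReal.toReal_le_of_le_ofReal (by linarith) hU.le
  have hlim := tendsto_mean_of_tendsto_mean_fourier hx
    (⟨fun z => (F z : ℂ), by fun_prop⟩ : C(UnitAddCircle, ℂ))
  simp only [ContinuousMap.coe_mk] at hlim
  rw [integral_complex_ofReal] at hlim
  have hlim' := (Complex.continuous_re.tendsto _).comp hlim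
  filter_upwards [hlim'.eventually_lt_const (u := b - a + ε) (by
    rw [Complex.ofReal_re]
    linarith)] with N hN
  refine lt_of_le_of_lt ?_ hN
  have e : (Complex.re ∘ fun N : ℕ => (1 / (N : ℂ)) *
      ∑ n ∈ Icc 1 N, (F (x n : UnitAddCircle) : ℂ)) N =
      (∑ n ∈ Icc 1 N, F (x n : UnitAddCircle)) / N := by
    have : (1 / (N : ℂ)) * ∑ n ∈ Icc 1 N, (F (x n : UnitAddCircle) : ℂ) =
        (((∑ n ∈ Icc 1 N, F (x n : UnitAddCircle)) / N : ℝ) : ℂ) := by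
      push_cast
      ring
    simp only [Function.comp_apply, this, Complex.ofReal_re]
  rw [e, proportion_eq_sum]
  gcongr with n _
  split_ifs with hn
  · have hmem : (x n : UnitAddCircle) ∈ K := by
      have habs : |Int.fract (x n) - (a + b) / 2| ≤ (b - a) / 2 := by
        have h1 := hn.1
        have h2 := hn.2
        rw [abs_le]
        constructor <;> linarith
      rw [hK, Metric.mem_closedBall, dist_eq_norm, ← AddCircle.coe_fract (x n),
        ← AddCircle.coe_sub, (AddCircle.norm_coe_eq_abs_iff 1 one_ne_zero).2]
      · exact habs
      · rw [abs_one]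
        linarith
    exact (hF1 hmem).ge
  · exact (hF _).1

/-- Upper bounds suffice: the lower bound for `[a, b)` follows from those for the complementary arcs
`[0, a)` and `[b, 1)`, as the three proportions add up to 1. -/
theorem uniformlyDistributedModOne_of_tendsto_mean_fourier {x : ℕ → ℝ}
    (hx : ∀ k : ℤ, k ≠ 0 → Tendsto (fun N : ℕ => (1 / (N : ℂ)) *
      ∑ n ∈ Icc 1 N, fourier k (x n : UnitAddCircle)) atTop (𝓝 0)) :
    UniformlyDistributedModOne x := by
  classical
  intro a b ha hab hb
  rw [hasNaturalDensity_iff_tendsto_proportion, tendsto_order]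
  refine ⟨fun c hc => ?_, fun c hc => ?_⟩
  · set ε := (b - a - c) / 2 with hε
    have hε0 : 0 < ε := by linarith
    filter_upwards [eventually_proportion_fract_lt_of_tendsto_mean_fourier hx le_rfl ha
      (hab.le.trans hb) hε0,
      eventually_proportion_fract_lt_of_tendsto_mean_fourier hx (ha.trans hab.le) hb le_rfl hε0,
      eventually_ge_atTop 1] with N h1 h2 hN
    have hsum : proportion {n | Int.fract (x n) ∈ Set.Ico 0 a} N
        + proportion {n | Int.fract (x n) ∈ Set.Ico a b} N
        + proportion {n | Int.fract (x n) ∈ Set.Ico b 1} N = 1 := by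
      have hN0 : (N : ℝ) ≠ 0 := by exact_mod_cast (by omega : N ≠ 0)
      simp only [proportion_eq_sum]
      rw [← add_div, ← add_div, div_eq_one_iff_eq hN0, ← Finset.sum_add_distrib,
        ← Finset.sum_add_distrib]
      rw [Finset.sum_congr rfl (g := fun _ => (1 : ℝ))]
      · simp
      · intro n _
        have h0 := Int.fract_nonneg (x n)
        have h1 := Int.fract_lt_one (x n)
        simp only [Set.mem_ofPred_eq, Set.mem_Ico]
        rcases lt_or_ge (Int.fract (x n)) a with h | h
        · simp [h0, h, not_le.2 h, not_le.2 (h.trans hab)]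
        · rcases lt_or_ge (Int.fract (x n)) b with h' | h'
          · simp [h, h', not_lt.2 h, not_le.2 h']
          · simp [h, h', not_lt.2 h, not_lt.2 h', h1]
    linarith
  · have := eventually_proportion_fract_lt_of_tendsto_mean_fourier hx ha hab.le hb
      (sub_pos.2 hc)
    simpa using this

/-! ### Consequences: roots of unity, residue classes, irrational rotations -/

/-- Powers `z ^ Ω(n)` with `z ≠ 1` on the unit circle have mean value zero. -/
theorem tendsto_mean_pow_cardFactors {z : ℂ} (hz : ‖z‖ = 1) (hz1 : z ≠ 1) :
    Tendsto (fun N : ℕ => (1 / (N : ℂ)) * ∑ n ∈ Icc 1 N, z ^ cardFactors n) atTop (𝓝 0) := by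
  -- For `f k = z ^ k` the difference of means is `z - 1` times the mean.
  have h := (tendsto_mean_cardFactors_add_one_sub (f := fun k => z ^ k)
    ⟨1, fun k => by simp [hz]⟩).const_mul (z - 1)⁻¹
  rw [mul_zero] at h
  refine h.congr fun N => ?_
  have : z - 1 ≠ 0 := sub_ne_zero.2 hz1
  simp only [pow_succ, ← Finset.sum_mul]
  field_simp

theorem tendsto_mean_liouville :
    Tendsto (fun N : ℕ => (1 / (N : ℝ)) * ∑ n ∈ Icc 1 N, (liouville n : ℝ)) atTop (𝓝 0) := by
  have h := (Complex.continuous_re.tendsto _).comp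
    (tendsto_mean_pow_cardFactors (z := -1) (by simp) (by norm_num))
  rw [Complex.zero_re] at h
  refine h.congr fun N => ?_
  have : (1 / (N : ℂ)) * ∑ n ∈ Icc 1 N, (-1) ^ cardFactors n =
      (((1 / (N : ℝ)) * ∑ n ∈ Icc 1 N, (liouville n : ℝ) : ℝ) : ℂ) := by
    push_cast
    congr 1
    refine Finset.sum_congr rfl fun n hn => ?_
    rw [liouville_apply (by have := (mem_Icc.1 hn).1; omega)]
    push_cast
    rfl
  rw [Function.comp_apply, this, Complex.ofReal_re]

/-- The main theorem for the indicator of a residue class shows that neighbouring classes have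
asymptotically equal proportions. The `m` proportions add up to 1, so each tends to `1 / m`. -/
theorem hasNaturalDensity_cardFactors_modEq {m : ℕ} (hm : 1 ≤ m) (r : ℕ) :
    HasNaturalDensity {n : ℕ | cardFactors n ≡ r [MOD m]} (1 / (m : ℝ)) := by
  classical
  set D : ℕ → ℕ → ℝ := fun i => proportion {n : ℕ | cardFactors n ≡ i [MOD m]} with hD
  have hstep (i : ℕ) : Tendsto (fun N => D i N - D (i + 1) N) atTop (𝓝 0) := by
    have h := (Complex.continuous_re.tendsto _).comp (tendsto_mean_cardFactors_add_one_sub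
      (f := fun k => if k ≡ i + 1 [MOD m] then 1 else 0)
      ⟨1, fun k => by split_ifs <;> simp⟩)
    rw [Complex.zero_re] at h
    refine h.congr fun N => ?_
    have hiff (n : ℕ) : (cardFactors n + 1 ≡ i + 1 [MOD m]) ↔ cardFactors n ≡ i [MOD m] :=
      ⟨Nat.ModEq.add_right_cancel' 1, Nat.ModEq.add_right 1⟩
    have e : ((D i N - D (i + 1) N : ℝ) : ℂ) =
        (1 / (N : ℂ)) * (∑ n ∈ Icc 1 N, if cardFactors n + 1 ≡ i + 1 [MOD m] then 1 else 0)
        - (1 / (N : ℂ)) * ∑ n ∈ Icc 1 N, if cardFactors n ≡ i + 1 [MOD m] then 1 else 0 := by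
      rw [Complex.ofReal_sub, hD, ofReal_proportion, ofReal_proportion]
      simp only [hiff, Set.mem_ofPred_eq]
      congr!
    rw [Function.comp_apply, ← e, Complex.ofReal_re]
  have hdiff0 (i : ℕ) : Tendsto (fun N => D 0 N - D i N) atTop (𝓝 0) := by
    induction i with
    | zero => simp
    | succ i ih => simpa using ih.add (hstep i)
  have hdiff (i : ℕ) : Tendsto (fun N => D r N - D i N) atTop (𝓝 0) := by
    simpa using (hdiff0 i).sub (hdiff0 r)
  have hsum : ∀ᶠ N in atTop, ∑ i ∈ range m, D i N = 1 := by
    filter_upwards [eventually_ge_atTop 1] with N hN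
    have hN0 : (N : ℝ) ≠ 0 := by exact_mod_cast (by omega : N ≠ 0)
    simp only [hD, proportion_eq_sum, Set.mem_ofPred_eq]
    rw [← Finset.sum_div, Finset.sum_comm, div_eq_one_iff_eq hN0]
    rw [Finset.sum_congr rfl (g := fun _ => (1 : ℝ))]
    · simp
    · intro n _
      rw [Finset.sum_eq_single_of_mem (cardFactors n % m)
        (mem_range.2 (Nat.mod_lt _ (by omega)))]
      · simp [Nat.ModEq]
      · intro i hi hne
        rw [if_neg]
        intro h
        apply hne
        rw [← Nat.mod_eq_of_lt (mem_range.1 hi)]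
        exact h.symm
  -- The sum plus 1 is eventually `m * D r N`.
  have hlim := (tendsto_finsetSum (range m) fun i _ => hdiff i).const_add 1
  have hm0 : (m : ℝ) ≠ 0 := by exact_mod_cast (by omega : m ≠ 0)
  rw [hasNaturalDensity_iff_tendsto_proportion]
  have hlim' := hlim.div_const (m : ℝ)
  simp only [Finset.sum_const_zero, add_zero] at hlim'
  refine hlim'.congr' ?_
  filter_upwards [hsum] with N hN
  rw [Finset.sum_sub_distrib, hN]
  simp only [sum_const, card_range, nsmul_eq_mul]
  rw [add_sub_cancel, mul_div_cancel_left₀ _ hm0]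

theorem uniformlyDistributedModOne_cardFactors_mul {α : ℝ} (hα : Irrational α) :
    UniformlyDistributedModOne (fun n : ℕ => (cardFactors n : ℝ) * α) := by
  refine uniformlyDistributedModOne_of_tendsto_mean_fourier fun k hk => ?_
  set z : ℂ := fourier k (α : UnitAddCircle) with hz
  have hz1 : z ≠ 1 := by
    intro h
    rw [hz, fourier_coe_apply, Complex.exp_eq_one_iff] at h
    obtain ⟨j, hj⟩ := h
    have hpi : (2 * Real.pi * Complex.I : ℂ) ≠ 0 := Complex.two_pi_I_ne_zero
    have h1 : (k * α : ℂ) = j := by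
      apply mul_left_cancel₀ hpi
      push_cast at hj
      rw [div_one] at hj
      linear_combination hj
    have h2 : (k : ℝ) * α = j := by exact_mod_cast h1
    exact (hα.intCast_mul hk).ne_int j h2
  refine (tendsto_mean_pow_cardFactors (z := z) ?_ hz1).congr fun N => ?_
  · rw [hz, fourier_apply]
    exact Circle.norm_coe _
  · congr 1
    refine Finset.sum_congr rfl fun n _ => ?_
    rw [hz, fourier_coe_apply, fourier_coe_apply, ← Complex.exp_nat_mul]
    congr 1
    push_cast
    ring

end

theorem theorem1 :
    -- the main result, for every bounded `f`
    (∀ f : ℕ → ℂ, (∃ C : ℝ, ∀ k : ℕ, ‖f k‖ ≤ C) →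
      Filter.Tendsto
        (fun N : ℕ =>
          (1 / (N : ℂ)) * ∑ n ∈ Finset.Icc 1 N, f (ArithmeticFunction.cardFactors n + 1)
            - (1 / (N : ℂ)) * ∑ n ∈ Finset.Icc 1 N, f (ArithmeticFunction.cardFactors n))
        Filter.atTop (nhds 0)) ∧
    -- the Liouville function has mean value zero
    Filter.Tendsto
      (fun N : ℕ =>
        (1 / (N : ℝ)) * ∑ n ∈ Finset.Icc 1 N, (ArithmeticFunction.liouville n : ℝ))
      Filter.atTop (nhds 0) ∧
    -- roots of unity
    (∀ (m : ℕ) (ζ : ℂ), 1 ≤ m → ζ ^ m = 1 → ζ ≠ 1 →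
      Filter.Tendsto
        (fun N : ℕ =>
          (1 / (N : ℂ)) * ∑ n ∈ Finset.Icc 1 N, ζ ^ ArithmeticFunction.cardFactors n)
        Filter.atTop (nhds 0)) ∧
    -- Pillai and Selberg
    (∀ m r : ℕ, 1 ≤ m → r < m →
      HasNaturalDensity {n : ℕ | ArithmeticFunction.cardFactors n ≡ r [MOD m]} (1 / (m : ℝ))) ∧
    -- Erdős and Delange
    (∀ α : ℝ, Irrational α →
      UniformlyDistributedModOne (fun n : ℕ => (ArithmeticFunction.cardFactors n : ℝ) * α)) := by
  refine ⟨fun f hf => tendsto_mean_cardFactors_add_one_sub hf, tendsto_mean_liouville,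
    fun m ζ hm hζ hζ1 => tendsto_mean_pow_cardFactors ?_ hζ1,
    fun m r hm _ => hasNaturalDensity_cardFactors_modEq hm r,
    fun α hα => uniformlyDistributedModOne_cardFactors_mul hα⟩
  exact Complex.norm_eq_one_of_pow_eq_one hζ (by omega)
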